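/- **Setting.** Let $C_{b,Lip}(V)$ be the bounded Lipschitz real functions on $V$. A sublinear expectation space $(\Omega,\mathcal H,\hat{\mathbb E})$ consists of a set $\Omega$, a linear space $\mathcal H$ of real functions on $\Omega$ with $\varphi(X_1,\dots,X_n)\in\mathcal H$ whenever $X_i\in\mathcal H$ and $\varphi\in C_{b,Lip}(\mathbb R^n)$, and a map $\hat{\mathbb E}:\mathcal H\to\mathbb R$ that is monotone, preserves constants, is sub-additive and is positively homogeneous. For $X:\Omega\to\mathbb R$ not necessarily in $\mathcal H$ put $\hat{\mathbb E}[X]:=\sup\{\hat{\mathbb E}[Y]:Y\in\mathcal H,\ Y\le X\}\in[-\infty,\infty]$, which is consistent on $\mathcal H$. A map $X:\Omega\to V$ is a ($V$-valued) random variable if $\varphi(X)\in\mathcal H$ for all $\varphi\in C_{b,Lip}(V)$; $X\overset d=Y$ means that $\varphi(X)$ and $\varphi(Y)$ have the same expectation for all such $\varphi$; and $Y$ is independent from $X$ if $(X,Y)$ is a random variable and $\hat{\mathbb E}[\varphi(X,Y)]=\hat{\mathbb E}\big[\hat{\mathbb E}[\varphi(x,Y)]_{x=X}\big]$ for all bounded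 Lipschitz $\varphi$. Let $\alpha\in(0,1]$ and $0<\underline\Lambda<\overline\Lambda$, let $S$ be the unit sphere of $\mathbb R^d$, and let $\mathcal L$ be the set of all measures $$F_\mu(B)=\int_S\mu(dz)\int_0^\infty \mathbf 1_B(rz)\,\frac{dr}{r^{1+\alpha}},\qquad B\in\mathcal B(\mathbb R^d),$$ with $\mu$ a symmetric finite measure on $S$ such that $\mu(S)\in(\underline\Lambda,\overline\Lambda)$. Let $C_b^3(\mathbb R^d)$ be the space of $C^3$ functions that are bounded together with their derivatives up to order $3$, and put $$\delta^\alpha_\lambda\varphi(x)=\begin{cases}\varphi(x+\lambda)-\varphi(x)-\langle D\varphi(x),\lambda\mathbf 1_{\{|\lambda|\le1\}}\rangle,&\alpha=1,\\ \varphi(x+\lambda)-\varphi(x),&\alpha\in(0,1).\end{cases}$$ Let $(Z_i)_{i\ge1}$ be $\mathbb R^d$-valued random variables on a sublinear expectation space $(\Omega,\mathcal H,\hat{\mathbb E})$ with $\hat{\mathbb E}[|Z_i|]=\infty$, $Z_{i+1}\overset d=Z_i$ and $Z_{i+1}$ independent from $(Z_1,\dots,Z_i)$ for all $i\ge1$,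 and let $S_n=Z_1+\dots+Z_n$. Assume: (A1) there is $0<\delta<\alpha$ with $\sup_{n\ge1}\hat{\mathbb E}\big[|n^{-1/\alpha}S_n|^\delta\big]<\infty$; (A2) for each $\varphi\in C_b^3(\mathbb R^d)$ there is a function $l$ with $l(s)\to0$ as $s\downarrow0$ such that, for all $s\in(0,1]$ and $x\in\mathbb R^d$, $$\frac1s\Big|\hat{\mathbb E}\big[\varphi(x+s^{1/\alpha}Z_1)-\varphi(x)\big]-s\sup_{F_\mu\in\mathcal L}\int_{\mathbb R^d}\delta^\alpha_\lambda\varphi(x)\,F_\mu(d\lambda)\Big|\le l(s).$$ Let $\tilde\Omega=D_0^d[0,1]$ be the set of càdlàg paths $\omega:[0,1]\to\mathbb R^d$ with $\omega_0=0$, let $\tilde\zeta_t(\omega)=\omega_t$, and let $Lip(\tilde\Omega)$ be the set of functions $\varphi(\tilde\zeta_{t_1},\tilde\zeta_{t_2}-\tilde\zeta_{t_1},\dots,\tilde\zeta_{t_n}-\tilde\zeta_{t_{n-1}})$ with $0\le t_1<\dots<t_n\le1$ and $\varphi\in C_{b,Lip}(\mathbb R^{d\times n})$. Call $\tilde{\mathbb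 E}$ a *limiting expectation* if it is a sublinear expectation on $(\tilde\Omega,Lip(\tilde\Omega))$ such that - $(\tilde\zeta_t)_{t\in[0,1]}$ is a nonlinear Lévy process under $\tilde{\mathbb E}$, i.e. it has càdlàg paths, $\tilde\zeta_0=0$, $\tilde\zeta_t-\tilde\zeta_s\overset d=\tilde\zeta_{t-s}$ for $0\le s\le t\le 1$, and $\tilde\zeta_t-\tilde\zeta_s$ is independent from $(\tilde\zeta_{t_1},\dots,\tilde\zeta_{t_n})$ for $0\le t_1\le\dots\le t_n\le s\le t\le1$; - for every $t\in[0,1]$, $(t/n)^{1/\alpha}S_n$ converges in distribution to $\tilde\zeta_t$, i.e. $\lim_{n\to\infty}\hat{\mathbb E}[\phi((t/n)^{1/\alpha}S_n)]=\tilde{\mathbb E}[\phi(\tilde\zeta_t)]$ for all $\phi\in C_{b,Lip}(\mathbb R^d)$. **Theorem.** Under these assumptions a limiting expectation exists. For every $\varphi\in C_b^3(\mathbb R^d)$ with $\varphi(0)=0$, the function $\lambda\mapsto\delta^\alpha_\lambda\varphi(0)$ is integrable with respect to every $F_\mu\in\mathcal L$, its integrals are bounded above over $\mathcal L$, and for every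 limiting expectation $\tilde{\mathbb E}$ $$\lim_{s\downarrow0}\frac{\tilde{\mathbb E}[\varphi(\tilde\zeta_s)]}{s}=\sup_{F_\mu\in\mathcal L}\int_{\mathbb R^d}\delta^\alpha_\lambda\varphi(0)\,F_\mu(d\lambda).$$ -/

import Mathlib

open Set Filter Topology MeasureTheory
open scoped NNReal ENNReal

noncomputable section

namespace NonlinearLevy

/-- The Euclidean space `ℝ^d`. -/
abbrev Euc (d : ℕ) : Type := EuclideanSpace ℝ (Fin d)

/-! ### Sublinear expectation spaces -/

/-- Bounded Lipschitz functions: the class `C_{b,Lip}(V)`. (On a finite-dimensional space this does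
not depend on the norm.) -/
def BddLip {V : Type*} [PseudoMetricSpace V] (φ : V → ℝ) : Prop :=
  (∃ C : ℝ, ∀ x, |φ x| ≤ C) ∧ ∃ K : ℝ≥0, LipschitzWith K φ

/-- `(Ω, H, E)` is a sublinear expectation space: `H` is a linear space of real functions on `Ω`,
stable under composition with bounded Lipschitz functions of finitely many of its members, and
`E : H → ℝ` is monotone, constant preserving, sub-additive and positively homogeneous.
`E` is written as a function of all `X : Ω → ℝ`; only its values on `H` are ever used. -/
structure IsSublinearExpectation {Ω : Type*} (H : Set (Ω → ℝ)) (E : (Ω → ℝ) → ℝ) : Prop where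
  zero_mem : (0 : Ω → ℝ) ∈ H
  add_mem : ∀ X ∈ H, ∀ Y ∈ H, X + Y ∈ H
  smul_mem : ∀ (c : ℝ), ∀ X ∈ H, c • X ∈ H
  comp_mem : ∀ (n : ℕ) (X : Fin n → Ω → ℝ), (∀ i, X i ∈ H) →
    ∀ φ : (Fin n → ℝ) → ℝ, BddLip φ → (fun ω => φ (fun i => X i ω)) ∈ H
  mono : ∀ X ∈ H, ∀ Y ∈ H, (∀ ω, Y ω ≤ X ω) → E Y ≤ E X
  const : ∀ c : ℝ, E (fun _ => c) = c
  subadd : ∀ X ∈ H, ∀ Y ∈ H, E (X + Y) ≤ E X + E Y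
  pos_homog : ∀ (c : ℝ), 0 < c → ∀ X ∈ H, E (c • X) = c * E X

/-- The value in `[-∞, ∞]` of the expectation at a function which need not belong to `H`:
`sup {E[Y] : Y ∈ H, Y ≤ X}`. It is `E[X]` for `X ∈ H` (`extExp_eq`), and it gives a meaning to
`E[|X|] = ∞` and to `E[|X|^δ] < ∞` for a random vector `X`. -/
def extExp {Ω : Type*} (H : Set (Ω → ℝ)) (E : (Ω → ℝ) → ℝ) (X : Ω → ℝ) : EReal :=
  ⨆ Y ∈ {Y : Ω → ℝ | Y ∈ H ∧ ∀ ω, Y ω ≤ X ω}, ((E Y : ℝ) : EReal)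

theorem extExp_eq {Ω : Type*} {H : Set (Ω → ℝ)} {E : (Ω → ℝ) → ℝ}
    (hE : IsSublinearExpectation H E) {X : Ω → ℝ} (hX : X ∈ H) :
    extExp H E X = ((E X : ℝ) : EReal) := by
  apply le_antisymm
  · refine iSup₂_le fun Y hY => ?_
    exact EReal.coe_le_coe_iff.2 (hE.mono X hX Y hY.1 hY.2)
  · exact le_iSup₂_of_le (f := fun (Y : Ω → ℝ) (_ : Y ∈ {Y : Ω → ℝ | Y ∈ H ∧ ∀ ω, Y ω ≤ X ω}) =>
      ((E Y : ℝ) : EReal)) X ⟨hX, fun _ => le_rfl⟩ le_rfl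

/-- `X` is a `V`-valued random variable: `φ(X) ∈ H` for all bounded Lipschitz `φ`. -/
def IsRandomVariable {Ω V : Type*} [PseudoMetricSpace V] (H : Set (Ω → ℝ)) (X : Ω → V) : Prop :=
  ∀ φ : V → ℝ, BddLip φ → (fun ω => φ (X ω)) ∈ H

/-- `X` and `Y` (possibly on different spaces) are identically distributed. -/
def IdentDist {Ω₁ Ω₂ V : Type*} [PseudoMetricSpace V] (E₁ : (Ω₁ → ℝ) → ℝ) (X : Ω₁ → V)
    (E₂ : (Ω₂ → ℝ) → ℝ) (Y : Ω₂ → V) : Prop :=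
  ∀ φ : V → ℝ, BddLip φ → E₁ (fun ω => φ (X ω)) = E₂ (fun ω => φ (Y ω))

/-- `Y` is independent from `X`: the pair `(X, Y)` is a random variable and
`E[φ(X, Y)] = E[E[φ(x, Y)]_{x = X}]` for all bounded Lipschitz `φ`. -/
def IndepFrom {Ω V W : Type*} [PseudoMetricSpace V] [PseudoMetricSpace W] (H : Set (Ω → ℝ))
    (E : (Ω → ℝ) → ℝ) (Y : Ω → W) (X : Ω → V) : Prop :=
  IsRandomVariable H (fun ω => (X ω, Y ω)) ∧
  ∀ φ : V × W → ℝ, BddLip φ →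
    E (fun ω => φ (X ω, Y ω)) = E (fun ω => E (fun ω' => φ (X ω, Y ω')))

/-- `Z 0, Z 1, …` is an i.i.d. sequence: each term has the distribution of the previous one and is
independent from the vector of all the previous ones. -/
structure IsIID {Ω V : Type*} [PseudoMetricSpace V] (H : Set (Ω → ℝ)) (E : (Ω → ℝ) → ℝ)
    (Z : ℕ → Ω → V) : Prop where
  randomVariable : ∀ i, IsRandomVariable H (Z i)
  identDist : ∀ i, IdentDist E (Z (i + 1)) E (Z i)
  indep : ∀ i, IndepFrom H E (Z (i + 1)) (fun ω (j : Fin (i + 1)) => Z j ω)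

/-- The partial sum `S_n` of the first `n` terms of the sequence. -/
def partialSum {Ω : Type*} {d : ℕ} (Z : ℕ → Ω → Euc d) (n : ℕ) (ω : Ω) : Euc d :=
  ∑ i ∈ Finset.range n, Z i ω

/-! ### Stable Lévy measures and the jump uncertainty set -/

/-- The unit sphere of `ℝ^d`. -/
abbrev Sph (d : ℕ) : Type := Metric.sphere (0 : Euc d) 1

/-- The `α`-stable Lévy measure
`F_μ(B) = ∫_S μ(dz) ∫_0^∞ 1_B(r z) r^{-1-α} dr`, as the image of `μ(dz) ⊗ r^{-1-α} dr` under
`(z, r) ↦ r z`. -/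
def stableMeasure {d : ℕ} (α : ℝ) (μ : Measure (Sph d)) : Measure (Euc d) :=
  Measure.map (fun p : Sph d × ℝ => p.2 • (p.1 : Euc d))
    (μ.prod ((volume.restrict (Ioi (0 : ℝ))).withDensity
      fun r => ENNReal.ofReal (r ^ (-(1 + α)))))

/-- The jump uncertainty set `𝓛`: all `F_μ` with `μ` a symmetric finite measure on the unit sphere
`S` with `μ(S) ∈ (Λlo, Λhi)`. -/
def jumpSet (d : ℕ) (α Λlo Λhi : ℝ) : Set (Measure (Euc d)) :=
  {F | ∃ μ : Measure (Sph d), IsFiniteMeasure μ ∧ Measure.map (fun z : Sph d => -z) μ = μ ∧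
    μ univ ∈ Ioo (ENNReal.ofReal Λlo) (ENNReal.ofReal Λhi) ∧ F = stableMeasure α μ}

/-- `C_b^3(ℝ^d)`: three times continuously differentiable functions, bounded together with their
derivatives up to order three. -/
def IsCb3 {d : ℕ} (φ : Euc d → ℝ) : Prop :=
  ContDiff ℝ 3 φ ∧ ∀ k : ℕ, k ≤ 3 → ∃ C : ℝ, ∀ x, ‖iteratedFDeriv ℝ k φ x‖ ≤ C

/-- `δ_y^α φ(x)` for `α ∈ (0, 1]`. -/
def jumpDiff {d : ℕ} (α : ℝ) (φ : Euc d → ℝ) (x y : Euc d) : ℝ :=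
  if α = 1 then φ (x + y) - φ x - fderiv ℝ φ x (if ‖y‖ ≤ 1 then y else 0)
  else φ (x + y) - φ x

/-- `sup_{F ∈ 𝓛} ∫ δ_y^α φ(x) F(dy)`. -/
def supGenerator {d : ℕ} (α Λlo Λhi : ℝ) (φ : Euc d → ℝ) (x : Euc d) : ℝ :=
  ⨆ F : jumpSet d α Λlo Λhi, ∫ y, jumpDiff α φ x y ∂(F : Measure (Euc d))

/-! ### The two assumptions on the sequence -/

/-- `δ`-moment condition: `sup_{n ≥ 1} E[|n^{-1/α} S_n|^δ] < ∞` for some `0 < δ < α`. -/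
def MomentCondition {Ω : Type*} {d : ℕ} (H : Set (Ω → ℝ)) (E : (Ω → ℝ) → ℝ) (α : ℝ)
    (Z : ℕ → Ω → Euc d) : Prop :=
  ∃ δ : ℝ, 0 < δ ∧ δ < α ∧
    (⨆ n : ℕ, ⨆ _ : 1 ≤ n,
      extExp H E (fun ω => ‖((n : ℝ) ^ (-(1 / α))) • partialSum Z n ω‖ ^ δ)) < ⊤

/-- Consistency condition on the common distribution of the sequence, with `Z₁` its first term. -/
def ConsistencyCondition {Ω : Type*} {d : ℕ} (E : (Ω → ℝ) → ℝ) (α Λlo Λhi : ℝ)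
    (Z₁ : Ω → Euc d) : Prop :=
  ∀ φ : Euc d → ℝ, IsCb3 φ → ∃ l : ℝ → ℝ, Tendsto l (𝓝[>] 0) (𝓝 0) ∧
    ∀ s ∈ Ioc (0 : ℝ) 1, ∀ x : Euc d,
      1 / s * |E (fun ω => φ (x + (s ^ (1 / α)) • Z₁ ω) - φ x) - s * supGenerator α Λlo Λhi φ x|
        ≤ l s

/-! ### Càdlàg paths and nonlinear Lévy processes on `[0, 1]` -/

/-- `f : [0, 1] → V` is right continuous with left limits. -/
def IsCadlag {V : Type*} [TopologicalSpace V] (f : unitInterval → V) : Prop :=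
  ∀ t, ContinuousWithinAt f (Ici t) t ∧ ∃ a, Tendsto f (𝓝[<] t) (𝓝 a)

/-- `D_0^d[0,1]`: the càdlàg paths in `ℝ^d` starting at the origin. -/
def PathSpace (d : ℕ) : Type := {w : unitInterval → Euc d // w 0 = 0 ∧ IsCadlag w}

/-- The canonical process `ζ_t(w) = w_t` on the path space. -/
def canonical (d : ℕ) (t : unitInterval) (w : PathSpace d) : Euc d := w.1 t

/-- `Lip(D_0^d[0,1])`: the functions `φ(ζ_{t₁}, ζ_{t₂} - ζ_{t₁}, …, ζ_{tₙ} - ζ_{tₙ₋₁})` with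
`0 ≤ t₁ < ⋯ < tₙ ≤ 1` and `φ` bounded Lipschitz. The first increment is written `ζ_{t₁} - ζ_0`,
and `ζ_0 = 0`. -/
def cylinderLip (d : ℕ) : Set (PathSpace d → ℝ) :=
  {X | ∃ (n : ℕ) (t : Fin n → unitInterval) (φ : (Fin n → Euc d) → ℝ), StrictMono t ∧ BddLip φ ∧
    X = fun w => φ (fun i => canonical d (t i) w -
      canonical d ((Fin.cons 0 t : Fin (n + 1) → unitInterval) i.castSucc) w)}

/-- `(X_t)_{t ∈ [0,1]}` is a nonlinear Lévy process on the sublinear expectation space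
`(Ω, H, E)`. -/
structure IsNonlinearLevy {Ω V : Type*} [SeminormedAddCommGroup V] (H : Set (Ω → ℝ))
    (E : (Ω → ℝ) → ℝ) (X : unitInterval → Ω → V) : Prop where
  randomVariable : ∀ t, IsRandomVariable H (X t)
  cadlag : ∀ ω, IsCadlag (fun t => X t ω)
  zero : ∀ ω, X 0 ω = 0
  stationary : ∀ s t r : unitInterval, (r : ℝ) = (t : ℝ) - (s : ℝ) →
    IdentDist E (fun ω => X t ω - X s ω) E (X r)
  indep : ∀ (n : ℕ) (τ : Fin n → unitInterval) (s t : unitInterval), Monotone τ →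
    (∀ i, τ i ≤ s) → s ≤ t →
    IndepFrom H E (fun ω => X t ω - X s ω) (fun ω (i : Fin n) => X (τ i) ω)

/-- `E'` is a sublinear expectation on `(D_0^d[0,1], Lip(D_0^d[0,1]))` under which the canonical
process `ζ` is the limiting process of the sequence `Z`: it is a nonlinear Lévy process and, for
every `t ∈ [0, 1]`, `(t/n)^{1/α} S_n` converges in distribution to `ζ_t` as `n → ∞`. -/
structure IsLimitProcess {Ω : Type*} {d : ℕ} (E : (Ω → ℝ) → ℝ) (α : ℝ) (Z : ℕ → Ω → Euc d)
    (E' : (PathSpace d → ℝ) → ℝ) : Prop where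
  sublinear : IsSublinearExpectation (cylinderLip d) E'
  levy : IsNonlinearLevy (cylinderLip d) E' (canonical d)
  limit : ∀ (t : unitInterval) (φ : Euc d → ℝ), BddLip φ →
    Tendsto (fun n : ℕ => E (fun ω => φ ((((t : ℝ) / (n : ℝ)) ^ (1 / α)) • partialSum Z n ω)))
      atTop (𝓝 (E' (fun w => φ (canonical d t w))))

end NonlinearLevy

end

open NonlinearLevy

namespace NonlinearLevy

/-! ### Bounded Lipschitz functions with explicit constants -/

/-! Write `T_s f(x) = E[f(x + s^{1/α} Z₁)]`. Independence turns the expectation of a function of `k`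
rescaled steps into an iterate of `T_h` (`IsIID.expect_pair_eq`), so the theorem is a nonlinear
Chernoff statement: `T_h^k` should converge as `h → 0` and `k h → t`, to a family whose derivative
at time zero is `G φ = sup_F ∫ δφ dF`. The special form of `G` plays no role in this; only the
consistency `T_s φ = φ + s G φ + o(s)`, uniform in space for `φ` in `C_b^3`, and the stable scaling
are used.

The core is a Cauchy estimate for the discretizations (`exists_abs_iterate_sub_iterate_le`). On a
block of short duration `τ` a good function `w` satisfies `T_h^q w = w + q h G w + o(τ)`, so two
discretizations differ by `o(τ)` on a block and by `o(1)` after about `1/τ` blocks. The iterates of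
`f` are only Lipschitz, hence are mollified. Since `T` is sublinear and commutes with translations,
Jensen's inequality gives `T(ρ * w) ≤ ρ * T w` (`IsSublinearOp.apply_mollify_le`); the mollifier
thus passes through every block, and its error is paid only at the two ends.

This needs the expansion uniformly over all `ρ * w` with `w` of given bound and Lipschitz constant
(`uniformlyConsistent_mollify`). On a large ball these `w` are totally bounded by Arzelà–Ascoli, and
the stable scaling makes the contribution of the complement small (`exists_tail_le`).

For existence, the laws of the rescaled walks are passed to the limit along an ultrafilter. The
result is a sublinear expectation at once, and the paths are càdlàg because the path space contains
no others. Stationarity, independence and convergence along the full sequence follow from the Cauchy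
estimate, which is uniform over functions with given constants.

For the derivative, under any limiting expectation the value at `φ(ζ_s)` is the limit of `T_{s/n}^n
φ(0)`. The short time expansion of iterates gives `s G φ(0) + o(s)` uniformly in large `n`, and this
survives the limit. -/

/-- `f` is bounded by `C` and Lipschitz with constant `K`. -/
def BddLipWith {V : Type*} [PseudoMetricSpace V] (C K : ℝ) (f : V → ℝ) : Prop :=
  (∀ x, |f x| ≤ C) ∧ ∀ x y, |f x - f y| ≤ K * dist x y

section BddLipWith

variable {V W : Type*} [PseudoMetricSpace V] [PseudoMetricSpace W] {C C' K K' : ℝ} {f g : V → ℝ}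

theorem BddLipWith.bddLip (h : BddLipWith C K f) : BddLip f := by
  refine ⟨⟨C, h.1⟩, K.toNNReal, LipschitzWith.of_dist_le_mul fun x y => ?_⟩
  rw [Real.dist_eq]
  exact (h.2 x y).trans (mul_le_mul_of_nonneg_right (Real.le_coe_toNNReal K) dist_nonneg)

theorem BddLip.exists_with (h : BddLip f) : ∃ C K : ℝ, 0 ≤ C ∧ 0 ≤ K ∧ BddLipWith C K f := by
  obtain ⟨⟨C, hC⟩, K, hK⟩ := h
  refine ⟨max C 0, K, le_max_right _ _, K.2, fun x => (hC x).trans (le_max_left _ _),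
    fun x y => ?_⟩
  simpa [Real.dist_eq] using hK.dist_le_mul x y

theorem BddLipWith.mono (h : BddLipWith C K f) (hC : C ≤ C') (hK : K ≤ K') :
    BddLipWith C' K' f :=
  ⟨fun x => (h.1 x).trans hC,
    fun x y => (h.2 x y).trans (mul_le_mul_of_nonneg_right hK dist_nonneg)⟩

theorem BddLipWith.continuous (h : BddLipWith C K f) : Continuous f :=
  h.bddLip.2.choose_spec.continuous

theorem BddLipWith.add (hf : BddLipWith C K f) (hg : BddLipWith C' K' g) :
    BddLipWith (C + C') (K + K') (fun x => f x + g x) := by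
  refine ⟨fun x => (abs_add_le _ _).trans (add_le_add (hf.1 x) (hg.1 x)), fun x y => ?_⟩
  calc |f x + g x - (f y + g y)| = |(f x - f y) + (g x - g y)| := by congr 1; ring
    _ ≤ K * dist x y + K' * dist x y :=
      (abs_add_le _ _).trans (add_le_add (hf.2 x y) (hg.2 x y))
    _ = _ := by ring

theorem BddLipWith.const_mul (hf : BddLipWith C K f) (c : ℝ) :
    BddLipWith (|c| * C) (|c| * K) (fun x => c * f x) := by
  refine ⟨fun x => ?_, fun x y => ?_⟩
  · rw [abs_mul]; exact mul_le_mul_of_nonneg_left (hf.1 x) (abs_nonneg c)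
  · rw [← mul_sub, abs_mul, mul_assoc]
    exact mul_le_mul_of_nonneg_left (hf.2 x y) (abs_nonneg c)

theorem BddLipWith.neg (hf : BddLipWith C K f) : BddLipWith C K (fun x => - f x) := by
  simpa using hf.const_mul (-1)

theorem BddLipWith.sub (hf : BddLipWith C K f) (hg : BddLipWith C' K' g) :
    BddLipWith (C + C') (K + K') (fun x => f x - g x) := by
  simpa [sub_eq_add_neg] using hf.add hg.neg

theorem bddLipWith_const (c : ℝ) : BddLipWith (V := V) |c| 0 (fun _ => c) := by
  simp [BddLipWith]

theorem BddLip.add (hf : BddLip f) (hg : BddLip g) : BddLip (fun x => f x + g x) := by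
  obtain ⟨C, K, -, -, h⟩ := hf.exists_with
  obtain ⟨C', K', -, -, h'⟩ := hg.exists_with
  exact (h.add h').bddLip

theorem BddLip.const_mul (hf : BddLip f) (c : ℝ) : BddLip (fun x => c * f x) := by
  obtain ⟨C, K, -, -, h⟩ := hf.exists_with
  exact (h.const_mul c).bddLip

theorem BddLip.neg (hf : BddLip f) : BddLip (fun x => - f x) := by
  simpa using hf.const_mul (-1)

theorem BddLip.sub (hf : BddLip f) (hg : BddLip g) : BddLip (fun x => f x - g x) := by
  simpa [sub_eq_add_neg] using hf.add hg.neg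

theorem bddLip_const (c : ℝ) : BddLip (fun _ : V => c) := (bddLipWith_const c).bddLip

theorem BddLip.comp (hf : BddLip f) {φ : W → V} {L : ℝ≥0} (hφ : LipschitzWith L φ) :
    BddLip (fun x => f (φ x)) := by
  obtain ⟨⟨C, hC⟩, K, hK⟩ := hf
  exact ⟨⟨C, fun x => hC _⟩, K * L, hK.comp hφ⟩

end BddLipWith

theorem BddLipWith.comp_add_right {V : Type*} [SeminormedAddCommGroup V] {C K : ℝ} {f : V → ℝ}
    (hf : BddLipWith C K f) (a : V) : BddLipWith C K (fun x => f (x + a)) :=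
  ⟨fun x => hf.1 _, fun x y => by simpa using hf.2 (x + a) (y + a)⟩

theorem BddLip.comp_add_right {V : Type*} [SeminormedAddCommGroup V] {f : V → ℝ}
    (hf : BddLip f) (a : V) : BddLip (fun x => f (x + a)) := by
  obtain ⟨C, K, -, -, h⟩ := hf.exists_with
  exact (h.comp_add_right a).bddLip

/-! ### Translation invariant sublinear operators -/

/-- A monotone, constant preserving, sublinear and translation invariant operator on the bounded
Lipschitz functions, which preserves bounds and Lipschitz constants. -/
structure IsSublinearOp {V : Type*} [SeminormedAddCommGroup V] (T : (V → ℝ) → V → ℝ) : Prop where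
  bddLipWith : ∀ {C K : ℝ} {f : V → ℝ}, BddLipWith C K f → BddLipWith C K (T f)
  mono : ∀ {f g : V → ℝ}, BddLip f → BddLip g → (∀ x, f x ≤ g x) → ∀ x, T f x ≤ T g x
  subadd : ∀ {f g : V → ℝ}, BddLip f → BddLip g → ∀ x,
    T (fun y => f y + g y) x ≤ T f x + T g x
  const_mul : ∀ {c : ℝ} {f : V → ℝ}, 0 ≤ c → BddLip f → ∀ x, T (fun y => c * f y) x = c * T f x
  const : ∀ c x, T (fun _ => c) x = c
  translate : ∀ (f : V → ℝ) (a x : V), T (fun y => f (y + a)) x = T f (x + a)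

namespace IsSublinearOp

variable {V : Type*} [SeminormedAddCommGroup V] {T T' : (V → ℝ) → V → ℝ} {f g : V → ℝ}

theorem bddLip (hT : IsSublinearOp T) (hf : BddLip f) : BddLip (T f) := by
  obtain ⟨C, K, -, -, h⟩ := hf.exists_with
  exact (hT.bddLipWith h).bddLip

theorem le_add_const (hT : IsSublinearOp T) (hf : BddLip f) (hg : BddLip g) {c : ℝ}
    (h : ∀ x, f x ≤ g x + c) (x : V) : T f x ≤ T g x + c := by
  refine (hT.mono hf (hg.add (bddLip_const c)) h x).trans ?_
  simpa [hT.const] using hT.subadd hg (bddLip_const c) x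

theorem le_add (hT : IsSublinearOp T) (hf : BddLip f) (hg : BddLip g) {k : V → ℝ} (hk : BddLip k)
    (h : ∀ x, f x ≤ g x + k x) (x : V) : T f x ≤ T g x + T k x :=
  (hT.mono hf (hg.add hk) h x).trans (hT.subadd hg hk x)

theorem le_add_add_const (hT : IsSublinearOp T) (hf : BddLip f) (hg : BddLip g) {k : V → ℝ}
    (hk : BddLip k) {c : ℝ} (h : ∀ x, f x ≤ g x + k x + c) (x : V) :
    T f x ≤ T g x + T k x + c := by
  have := hT.le_add_const hf (hg.add hk) h x
  have := hT.subadd hg hk x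
  linarith

theorem abs_sub_le (hT : IsSublinearOp T) (hf : BddLip f) (hg : BddLip g) {c : ℝ}
    (h : ∀ x, |f x - g x| ≤ c) (x : V) : |T f x - T g x| ≤ c := by
  have h1 := hT.le_add_const hf hg (c := c) (fun y => by linarith [le_abs_self (f y - g y), h y]) x
  have h2 := hT.le_add_const hg hf (c := c) (fun y => by linarith [neg_abs_le (f y - g y), h y]) x
  exact abs_le.2 ⟨by linarith, by linarith⟩

theorem id : IsSublinearOp (fun f : V → ℝ => f) where
  bddLipWith h := h
  mono _ _ h := h
  subadd _ _ _ := le_rfl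
  const_mul _ _ _ := rfl
  const _ _ := rfl
  translate _ _ _ := rfl

theorem comp (hT : IsSublinearOp T) (hT' : IsSublinearOp T') : IsSublinearOp (fun f => T (T' f)) where
  bddLipWith h := hT.bddLipWith (hT'.bddLipWith h)
  mono hf hg h := hT.mono (hT'.bddLip hf) (hT'.bddLip hg) (hT'.mono hf hg h)
  subadd hf hg x := hT.le_add (hT'.bddLip (hf.add hg)) (hT'.bddLip hf) (hT'.bddLip hg)
    (hT'.subadd hf hg) x
  const_mul {c f} hc hf x := by
    have : T' (fun y => c * f y) = fun y => c * T' f y := funext (hT'.const_mul hc hf)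
    rw [this, hT.const_mul hc (hT'.bddLip hf)]
  const c x := by
    have : T' (fun _ => c) = fun _ => c := funext (hT'.const c)
    rw [this, hT.const]
  translate f a x := by
    have : T' (fun y => f (y + a)) = fun y => T' f (y + a) := funext (hT'.translate f a)
    rw [this, hT.translate]

theorem iterate (hT : IsSublinearOp T) (n : ℕ) : IsSublinearOp (T^[n]) := by
  induction n with
  | zero => exact id
  | succ n ih => exact ih.comp hT

/-- A sublinear operator commutes with averages up to an inequality. -/
theorem apply_integral_le {V : Type*} [NormedAddCommGroup V] [MeasurableSpace V]
    [BorelSpace V] [SecondCountableTopology V]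
    {T : (V → ℝ) → V → ℝ} (hT : IsSublinearOp T) (ν : Measure V) [IsFiniteMeasure ν]
    {F : V → V → ℝ} {A C K b : ℝ} {x : V} (hF : ∀ z, BddLipWith C K (F z))
    (hA : ∀ z z' y, |F z y - F z' y| ≤ A * dist z z') (hb : ∀ᵐ z ∂ν, T (F z) x ≤ b) :
    T (fun y => ∫ z, F z y ∂ν) x ≤ ν.real univ * b := by
  rcases eq_zero_or_neZero ν with h0 | h0
  · subst h0
    simp [hT.const]
  -- The average over `z` is taken as a Bochner integral in the space of bounded continuous
  -- functions, so that Jensen's inequality becomes: averages stay in closed convex sets.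
  let u : V → BoundedContinuousFunction V ℝ := fun z =>
    BoundedContinuousFunction.ofNormedAddCommGroup (F z) (hF z).continuous C (hF z).1
  have hu : ∀ z y, u z y = F z y := fun z y => rfl
  have hucont : Continuous u := by
    have : LipschitzWith A.toNNReal u := LipschitzWith.of_dist_le_mul fun z z' => by
      have h1 : A * dist z z' ≤ A.toNNReal * dist z z' :=
        mul_le_mul_of_nonneg_right (Real.le_coe_toNNReal A) dist_nonneg
      rw [BoundedContinuousFunction.dist_le (by positivity)]
      intro y
      rw [Real.dist_eq]
      exact (hA z z' y).trans h1
    exact this.continuous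
  have hC0 : 0 ≤ C := (abs_nonneg _).trans ((hF 0).1 0)
  have hint : Integrable u ν := by
    refine Integrable.of_bound hucont.aestronglyMeasurable C (ae_of_all _ fun z => ?_)
    rw [BoundedContinuousFunction.norm_le hC0]
    exact (hF z).1
  -- The constants `C` and `K` are part of the set so that uniform limits stay bounded Lipschitz,
  -- where `T` is controlled. Convexity is the sublinearity of `T`; closedness is its contractivity
  -- in the uniform norm.
  let S : Set (BoundedContinuousFunction V ℝ) := {v | BddLipWith C K v ∧ T v x ≤ b}
  have hS : Convex ℝ S := by
    intro v hv w hw p q hp hq hpq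
    have hfun : ((p • v + q • w : BoundedContinuousFunction V ℝ) : V → ℝ)
      = fun y => p * v y + q * w y := by ext y; simp
    refine ⟨?_, ?_⟩
    · rw [hfun]
      refine ((hv.1.const_mul p).add (hw.1.const_mul q)).mono ?_ ?_
      · rw [abs_of_nonneg hp, abs_of_nonneg hq, ← add_mul, hpq, one_mul]
      · rw [abs_of_nonneg hp, abs_of_nonneg hq, ← add_mul, hpq, one_mul]
    · rw [hfun]
      refine (hT.subadd (hv.1.bddLip.const_mul p) (hw.1.bddLip.const_mul q) x).trans ?_
      rw [hT.const_mul hp hv.1.bddLip, hT.const_mul hq hw.1.bddLip]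
      calc p * T v x + q * T w x ≤ p * b + q * b :=
            add_le_add (mul_le_mul_of_nonneg_left hv.2 hp) (mul_le_mul_of_nonneg_left hw.2 hq)
        _ = b := by rw [← add_mul, hpq, one_mul]
  have hSc : IsClosed S := by
    refine isClosed_of_closure_subset fun v hv => ?_
    have happ : ∀ e > 0, ∃ w ∈ S, ∀ y, |v y - w y| ≤ e := by
      intro e he
      obtain ⟨w, hw, hd⟩ := Metric.mem_closure_iff.1 hv e he
      exact ⟨w, hw, fun y => by
        rw [← Real.dist_eq]; exact (BoundedContinuousFunction.dist_coe_le_dist y).trans hd.le⟩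
    have hvBL : BddLipWith C K v := by
      refine ⟨fun y => ?_, fun y y' => ?_⟩
      · refine le_of_forall_pos_le_add fun e he => ?_
        obtain ⟨w, hw, hd⟩ := happ e he
        have h1 := abs_sub_abs_le_abs_sub (v y) (w y)
        linarith [hd y, hw.1.1 y]
      · refine le_of_forall_pos_le_add fun e he => ?_
        obtain ⟨w, hw, hd⟩ := happ (e / 2) (by positivity)
        have h1 : v y - v y' = (v y - w y) + (w y - w y') + -(v y' - w y') := by ring
        rw [h1]
        have h2 := abs_add_three (v y - w y) (w y - w y') (-(v y' - w y'))
        rw [abs_neg] at h2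
        linarith [hd y, hd y', hw.1.2 y y']
    refine ⟨hvBL, le_of_forall_pos_le_add fun e he => ?_⟩
    obtain ⟨w, hw, hd⟩ := happ e he
    have := hT.le_add_const hvBL.bddLip hw.1.bddLip (c := e)
      (fun y => by linarith [le_abs_self (v y - w y), hd y]) x
    linarith [hw.2]
  have hmem := hS.average_mem hSc (μ := ν) (f := u) (hb.mono fun z hz => ⟨hF z, hz⟩) hint
  have heval : ∀ y, (∫ z, u z ∂ν) y = ∫ z, F z y ∂ν := fun y => by
    have := (BoundedContinuousFunction.evalCLM ℝ y).integral_comp_comm hint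
    simpa [hu] using this.symm
  have hm : 0 < ν.real univ := by
    rw [measureReal_def]
    exact ENNReal.toReal_pos (by simpa using h0.out) (measure_ne_top _ _)
  have havg : (fun y => ∫ z, F z y ∂ν)
      = fun y => ν.real univ * (⨍ z, u z ∂ν : BoundedContinuousFunction V ℝ) y := by
    ext y
    rw [average_eq, BoundedContinuousFunction.coe_smul]
    dsimp only
    rw [heval, smul_eq_mul, ← mul_assoc, mul_inv_cancel₀ hm.ne', one_mul]
  rw [havg, hT.const_mul hm.le hmem.1.bddLip]
  exact mul_le_mul_of_nonneg_left hmem.2 hm.le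

end IsSublinearOp

/-! ### Smooth bounded functions and mollification -/

theorem IsCb3.bddLip {d : ℕ} {φ : Euc d → ℝ} (h : IsCb3 φ) : BddLip φ := by
  obtain ⟨C, hC⟩ := h.2 0 (by norm_num)
  obtain ⟨K, hK⟩ := h.2 1 (by norm_num)
  refine ⟨⟨C, fun x => by simpa using hC x⟩, K.toNNReal, ?_⟩
  refine lipschitzWith_of_nnnorm_fderiv_le (𝕜 := ℝ) (h.1.differentiable (by norm_num)) fun x => ?_
  have h1 : ‖fderiv ℝ φ x‖ ≤ K := by
    have := hK x
    rwa [← norm_iteratedFDeriv_fderiv, norm_iteratedFDeriv_zero] at this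
  exact NNReal.coe_le_coe.1 (h1.trans (Real.le_coe_toNNReal K))

theorem isCb3_of_hasCompactSupport {d : ℕ} {φ : Euc d → ℝ} (h : ContDiff ℝ 3 φ)
    (hc : HasCompactSupport φ) : IsCb3 φ := by
  refine ⟨h, fun k hk => ?_⟩
  exact (hc.iteratedFDeriv (𝕜 := ℝ) k).exists_bound_of_continuous
    (h.continuous_iteratedFDeriv (by exact_mod_cast hk))

theorem IsCb3.const_add {d : ℕ} {φ : Euc d → ℝ} (h : IsCb3 φ) (c : ℝ) :
    IsCb3 (fun x => c + φ x) := by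
  refine ⟨contDiff_const.add h.1, fun k hk => ?_⟩
  obtain ⟨C, hC⟩ := h.2 k hk
  rcases Nat.eq_zero_or_pos k with rfl | hk0
  · refine ⟨|c| + C, fun x => ?_⟩
    have h1 := hC x
    rw [norm_iteratedFDeriv_zero] at h1 ⊢
    exact (norm_add_le _ _).trans (by rw [Real.norm_eq_abs c]; linarith)
  · refine ⟨C, fun x => ?_⟩
    have h2 : ContDiffAt ℝ k φ x := (h.1.of_le (by exact_mod_cast hk)).contDiffAt
    have h3 : iteratedFDeriv ℝ k (fun x => c + φ x) x = iteratedFDeriv ℝ k φ x := by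
      rw [fun_iteratedFDeriv_add_apply contDiffAt_const h2,
        iteratedFDeriv_const_of_ne hk0.ne', Pi.zero_apply, zero_add]
    rw [h3]; exact hC x

theorem IsCb3.neg {d : ℕ} {φ : Euc d → ℝ} (h : IsCb3 φ) : IsCb3 (fun x => - φ x) := by
  refine ⟨h.1.neg, fun k hk => ?_⟩
  obtain ⟨C, hC⟩ := h.2 k hk
  refine ⟨C, fun x => ?_⟩
  have : iteratedFDeriv ℝ k (fun x => - φ x) x = - iteratedFDeriv ℝ k φ x :=
    iteratedFDeriv_neg_apply
  rw [this, norm_neg]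
  exact hC x

/-- All derivatives fall on `g`, so only the supremum of `w` enters. The target spaces and the
pairing `L` vary because `fderiv ℝ g` is again a compactly supported smooth function, with values in
linear maps, to which the induction hypothesis is applied. -/
theorem exists_bound_iteratedFDeriv_convolution {d : ℕ} {w : Euc d → ℝ} {C : ℝ}
    (hw : Continuous w) (hC : ∀ x, |w x| ≤ C) (k : ℕ) :
    ∀ {E' F : Type} [NormedAddCommGroup E'] [NormedSpace ℝ E'] [NormedAddCommGroup F]
      [NormedSpace ℝ F] (L : ℝ →L[ℝ] E' →L[ℝ] F) {g : Euc d → E'}, ContDiff ℝ (⊤ : ℕ∞) g →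
      HasCompactSupport g →
      ∃ B : ℝ, ∀ x, ‖iteratedFDeriv ℝ k (convolution w g L volume) x‖ ≤ B := by
  induction k with
  | zero =>
    intro E' F _ _ _ _ L g hg hgc
    refine ⟨∫ t, ‖L‖ * C * ‖g t‖, fun x => ?_⟩
    rw [norm_iteratedFDeriv_zero, convolution_def,
      ← integral_sub_left_eq_self (fun t => ‖L‖ * C * ‖g t‖) volume x]
    have hgi : Integrable (fun t => ‖g t‖) (volume : Measure (Euc d)) :=
      (hg.continuous.integrable_of_hasCompactSupport hgc).norm
    refine norm_integral_le_of_norm_le ((hgi.const_mul (‖L‖ * C)).comp_sub_left x)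
      (ae_of_all _ fun t => ?_)
    calc ‖L (w t) (g (x - t))‖ ≤ ‖L‖ * ‖w t‖ * ‖g (x - t)‖ := L.le_opNorm₂ _ _
      _ ≤ ‖L‖ * C * ‖g (x - t)‖ := by
        gcongr
        exact hC t
  | succ k ih =>
    intro E' F _ _ _ _ L g hg hgc
    have hd : fderiv ℝ (convolution w g L volume)
        = convolution w (fderiv ℝ g) (L.precompR (Euc d)) volume := by
      ext1 x
      exact (hgc.hasFDerivAt_convolution_right L hw.locallyIntegrable
        (hg.of_le (by exact_mod_cast le_top)) x).fderiv
    obtain ⟨B, hB⟩ := ih (L.precompR (Euc d)) (g := fderiv ℝ g)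
      (hg.fderiv_right (by exact_mod_cast le_top)) (hgc.fderiv ℝ)
    refine ⟨B, fun x => ?_⟩
    rw [← norm_iteratedFDeriv_fderiv, hd]
    exact hB x

/-- The mollification of `w` by the normed bump function `ρ`. -/
noncomputable def mollify {d : ℕ} (ρ : ContDiffBump (0 : Euc d)) (w : Euc d → ℝ) (x : Euc d) : ℝ :=
  ∫ z, ρ.normed volume z * w (x - z)

section Mollify

variable {d : ℕ} (ρ : ContDiffBump (0 : Euc d)) {w v : Euc d → ℝ} {C K : ℝ}

theorem isCb3_normed : IsCb3 (ρ.normed (volume : Measure (Euc d))) :=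
  isCb3_of_hasCompactSupport ρ.contDiff_normed ρ.hasCompactSupport_normed

theorem mollify_eq (w : Euc d → ℝ) (x : Euc d) :
    mollify ρ w x = ∫ z, w z * ρ.normed volume (x - z) := by
  rw [mollify, ← integral_sub_left_eq_self _ volume x]
  simp only [sub_sub_cancel]
  exact integral_congr_ae (ae_of_all _ fun z => mul_comm _ _)

theorem mollify_eq_convolution (w : Euc d → ℝ) :
    mollify ρ w = convolution w (ρ.normed volume) (ContinuousLinearMap.lsmul ℝ ℝ) volume := by
  ext x
  rw [mollify_eq, convolution_def]
  rfl

theorem isCb3_mollify (hw : BddLip w) : IsCb3 (mollify ρ w) := by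
  obtain ⟨C, K, -, -, h⟩ := hw.exists_with
  rw [mollify_eq_convolution]
  refine ⟨?_, fun k _ => exists_bound_iteratedFDeriv_convolution h.continuous h.1 k _
    ρ.contDiff_normed ρ.hasCompactSupport_normed⟩
  exact ρ.hasCompactSupport_normed.contDiff_convolution_right _
    h.continuous.locallyIntegrable ρ.contDiff_normed

theorem integrable_normed_mul (hw : Continuous w) (x : Euc d) :
    Integrable (fun z => ρ.normed volume z * w (x - z)) (volume : Measure (Euc d)) := by
  refine (ρ.continuous_normed.mul (hw.comp (continuous_const.sub continuous_id)))
    |>.integrable_of_hasCompactSupport ?_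
  exact ρ.hasCompactSupport_normed.mul_right

theorem integrable_mul_normed (hw : Continuous w) (x : Euc d) :
    Integrable (fun z => w z * ρ.normed volume (x - z)) (volume : Measure (Euc d)) := by
  have := (integrable_normed_mul ρ hw x).comp_sub_left x
  simp only [sub_sub_cancel] at this
  exact this.congr (ae_of_all _ fun z => mul_comm _ _)

theorem mollify_sub (hw : Continuous w) (hv : Continuous v) (x : Euc d) :
    mollify ρ (fun y => w y - v y) x = mollify ρ w x - mollify ρ v x := by
  rw [mollify, mollify, mollify, ← integral_sub (integrable_normed_mul ρ hw x)
    (integrable_normed_mul ρ hv x)]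
  simp only [mul_sub]

theorem mollify_const (c : ℝ) (x : Euc d) : mollify ρ (fun _ => c) x = c := by
  rw [mollify, integral_mul_const, ρ.integral_normed, one_mul]

theorem mollify_mono (hw : Continuous w) (hv : Continuous v) {x : Euc d}
    (h : ∀ z, ‖z‖ < ρ.rOut → w (x - z) ≤ v (x - z)) : mollify ρ w x ≤ mollify ρ v x := by
  refine integral_mono (integrable_normed_mul ρ hw x) (integrable_normed_mul ρ hv x) fun z => ?_
  by_cases hz : ‖z‖ < ρ.rOut
  · exact mul_le_mul_of_nonneg_left (h z hz) (ρ.nonneg_normed z)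
  · have : ρ.normed (volume : Measure (Euc d)) z = 0 := by
      rw [← Function.notMem_support, ρ.support_normed_eq]
      simpa using hz
    simp [this]

theorem mollify_le (hw : Continuous w) {x : Euc d} {c : ℝ}
    (h : ∀ z, ‖z‖ < ρ.rOut → w (x - z) ≤ c) : mollify ρ w x ≤ c :=
  (mollify_mono ρ hw continuous_const h).trans (mollify_const ρ c x).le

theorem le_mollify (hw : Continuous w) {x : Euc d} {c : ℝ}
    (h : ∀ z, ‖z‖ < ρ.rOut → c ≤ w (x - z)) : c ≤ mollify ρ w x :=
  (mollify_const ρ c x).ge.trans (mollify_mono ρ continuous_const hw h)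

theorem BddLipWith.mollify (hw : BddLipWith C K w) : BddLipWith C K (mollify ρ w) := by
  refine ⟨fun x => abs_le.2 ⟨le_mollify ρ hw.continuous fun z _ => (abs_le.1 (hw.1 _)).1,
    mollify_le ρ hw.continuous fun z _ => (abs_le.1 (hw.1 _)).2⟩, fun x y => ?_⟩
  have hcont : Continuous fun z => w (z + (y - x)) :=
    hw.continuous.comp (continuous_id.add continuous_const)
  have h1 : NonlinearLevy.mollify ρ w y = NonlinearLevy.mollify ρ (fun z => w (z + (y - x))) x := by
    refine integral_congr_ae (ae_of_all _ fun z => ?_)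
    simp only
    congr 2
    abel
  rw [h1, ← mollify_sub ρ hw.continuous hcont]
  have h2 : ∀ z, |w (x - z) - w (x - z + (y - x))| ≤ K * dist x y := fun z => by
    refine (hw.2 _ _).trans (le_of_eq ?_)
    simp [dist_eq_norm]
  exact abs_le.2 ⟨le_mollify ρ (hw.continuous.sub hcont) fun z _ => (abs_le.1 (h2 z)).1,
    mollify_le ρ (hw.continuous.sub hcont) fun z _ => (abs_le.1 (h2 z)).2⟩

theorem abs_mollify_sub_le (hK : 0 ≤ K) (hw : BddLipWith C K w) (x : Euc d) :
    |mollify ρ w x - w x| ≤ K * ρ.rOut := by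
  have h2 : ∀ z, ‖z‖ < ρ.rOut → |w (x - z) - w x| ≤ K * ρ.rOut := fun z hz => by
    refine (hw.2 _ _).trans (mul_le_mul_of_nonneg_left ?_ hK)
    simpa [dist_eq_norm] using hz.le
  have h3 : mollify ρ w x - w x = mollify ρ (fun y => w y - w x) x := by
    rw [mollify_sub ρ hw.continuous continuous_const, mollify_const]
  have hcont : Continuous fun y => w y - w x := hw.continuous.sub continuous_const
  rw [h3]
  exact abs_le.2 ⟨le_mollify ρ hcont fun z hz => (abs_le.1 (h2 z hz)).1,
    mollify_le ρ hcont fun z hz => (abs_le.1 (h2 z hz)).2⟩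

end Mollify

/-- A smooth function, quadratic near the origin and equal to `1` far away. -/
theorem exists_isCb3_min_sq_le (d : ℕ) :
    ∃ ψ : Euc d → ℝ, IsCb3 ψ ∧ ψ 0 = 0 ∧ ∀ x, min (‖x‖ ^ 2) 1 ≤ ψ x := by
  let χ : ContDiffBump (0 : Euc d) := ⟨1, 2, one_pos, one_lt_two⟩
  -- An interpolation between `‖x‖ ^ 2`, where `χ = 1`, and `1`, where `χ = 0`; being a constant
  -- plus a compactly supported function, it has bounded derivatives.
  refine ⟨fun x => 1 + χ x * (‖x‖ ^ 2 - 1), IsCb3.const_add (isCb3_of_hasCompactSupport ?_ ?_) 1,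
    ?_, fun x => ?_⟩
  · exact χ.contDiff.mul ((contDiff_norm_sq ℝ).sub contDiff_const)
  · exact χ.hasCompactSupport.mul_right
  · have : χ 0 = 1 := χ.one_of_mem_closedBall (by simp [χ])
    simp [this]
  · have h0 := χ.nonneg (x := x)
    have h1 := χ.le_one (x := x)
    rcases le_total ‖x‖ 1 with h | h
    · have : χ x = 1 := χ.one_of_mem_closedBall (by simpa [χ] using h)
      simp [this]
    · have : 1 ≤ ‖x‖ ^ 2 := one_le_pow₀ h
      exact (min_le_right _ _).trans (by nlinarith)

/-- Mollification commutes with sublinear translation invariant operators up to an inequality. -/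
theorem IsSublinearOp.apply_mollify_le {d : ℕ} {T : (Euc d → ℝ) → Euc d → ℝ}
    (hT : IsSublinearOp T) (ρ : ContDiffBump (0 : Euc d)) {w : Euc d → ℝ} (hw : BddLip w)
    (x : Euc d) : T (mollify ρ w) x ≤ mollify ρ (T w) x := by
  obtain ⟨C, K, hC, hK, hwL⟩ := hw.exists_with
  have hTw := hT.bddLipWith hwL
  obtain ⟨Cρ, Kρ, hCρ, hKρ, hρ⟩ := (isCb3_normed ρ).bddLip.exists_with
  set B : Set (Euc d) := Metric.closedBall 0 ρ.rOut
  have hBfin : IsFiniteMeasure (volume.restrict B) :=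
    ⟨by simpa using! (isCompact_closedBall (0 : Euc d) ρ.rOut).measure_lt_top⟩
  have hsupp : ∀ f : Euc d → ℝ, ∫ z in B, ρ.normed volume z * f z
      = ∫ z, ρ.normed volume z * f z := fun f => by
    refine setIntegral_eq_integral_of_forall_compl_eq_zero fun z hz => ?_
    have : ρ.normed (volume : Measure (Euc d)) z = 0 := by
      rw [← Function.notMem_support, ρ.support_normed_eq]
      exact fun h => hz (Metric.ball_subset_closedBall h)
    rw [this, zero_mul]
  have hshift : ∀ z, BddLipWith C K (fun y => w (y - z)) := fun z => by
    simpa [sub_eq_add_neg] using hwL.comp_add_right (-z)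
  have hdiff : ∀ z, BddLipWith (2 * C) K (fun y => w (y - z) - T w (x - z)) := fun z => by
    refine ((hshift z).sub ((bddLipWith_const (T w (x - z))).mono (hTw.1 _) le_rfl)).mono ?_ ?_
    · linarith
    · linarith
  -- Jensen is applied to translates centred at their own image, `w(y - z) - T w(x - z)`: by
  -- translation invariance `T` of each is nonpositive at `x`, hence the bound `b = 0`. Restricting
  -- to the support of `ρ` makes the measure finite.
  have key := hT.apply_integral_le (volume.restrict B)
    (F := fun z y => ρ.normed volume z * (w (y - z) - T w (x - z)))
    (A := Kρ * (2 * C) + Cρ * (2 * K)) (C := Cρ * (2 * C)) (K := Cρ * K) (b := 0) (x := x)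
    (fun z => ((hdiff z).const_mul _).mono
      (mul_le_mul_of_nonneg_right (hρ.1 z) (by positivity))
      (mul_le_mul_of_nonneg_right (hρ.1 z) hK))
    (fun z z' y => by
      have e1 : ρ.normed volume z * (w (y - z) - T w (x - z))
          - ρ.normed volume z' * (w (y - z') - T w (x - z'))
          = (ρ.normed volume z - ρ.normed volume z') * (w (y - z) - T w (x - z))
            + ρ.normed volume z' * ((w (y - z) - w (y - z')) - (T w (x - z) - T w (x - z'))) := by
        ring
      have e2 := hwL.2 (y - z) (y - z')
      have e3 := hTw.2 (x - z) (x - z')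
      rw [dist_sub_left] at e2 e3
      rw [e1]
      refine (abs_add_le _ _).trans ?_
      rw [abs_mul, abs_mul]
      have e4 : |(w (y - z) - w (y - z')) - (T w (x - z) - T w (x - z'))| ≤ 2 * K * dist z z' :=
        (abs_sub _ _).trans (by linarith)
      calc _ ≤ Kρ * dist z z' * (2 * C) + Cρ * (2 * K * dist z z') := by
            gcongr
            · exact hρ.2 z z'
            · exact (hdiff z).1 y
            · exact hρ.1 z'
        _ = _ := by ring)
    (ae_of_all _ fun z => by
      rw [hT.const_mul (ρ.nonneg_normed z) (hdiff z).bddLip]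
      refine mul_nonpos_of_nonneg_of_nonpos (ρ.nonneg_normed z) ?_
      have h1 := hT.translate w (-z) x
      simp only [← sub_eq_add_neg] at h1
      have h2 := hT.le_add_const (hdiff z).bddLip (hshift z).bddLip (c := - T w (x - z))
        (fun y => by linarith) x
      linarith)
  have h1 : ∀ y, ∫ z in B, ρ.normed volume z * (w (y - z) - T w (x - z))
      = mollify ρ w y - mollify ρ (T w) x := fun y => by
    rw [hsupp (fun z => w (y - z) - T w (x - z)), mollify, mollify,
      ← integral_sub (integrable_normed_mul ρ hwL.continuous y)
        (integrable_normed_mul ρ hTw.continuous x)]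
    simp only [mul_sub]
  simp only [h1, mul_zero] at key
  have := hT.le_add_const (hwL.mollify ρ).bddLip
    ((hwL.mollify ρ).bddLip.sub (bddLip_const (mollify ρ (T w) x)))
    (c := mollify ρ (T w) x) (fun y => by linarith) x
  linarith

/-! ### Chernoff families -/

/-- A family `T s` of sublinear operators with the `α`-stable scaling and with derivative `G` at
`s = 0`, uniformly on `ℝ^d`, at each function in `C_b^3`. -/
structure IsChernoffFamily {d : ℕ} (α : ℝ) (T : ℝ → (Euc d → ℝ) → Euc d → ℝ)
    (G : (Euc d → ℝ) → Euc d → ℝ) : Prop where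
  pos : 0 < α
  op : ∀ s, IsSublinearOp (T s)
  scale : ∀ (s R : ℝ), 0 < s → 0 < R → ∀ f : Euc d → ℝ,
    T s (fun y => f (R⁻¹ • y)) 0 = T (s * R ^ (-α)) f 0
  consistent : ∀ φ, IsCb3 φ → ∀ e > 0, ∀ᶠ s in 𝓝[>] (0 : ℝ), ∀ x,
    |T s φ x - φ x - s * G φ x| ≤ s * e

/-- Uniform consistency on a set of functions. -/
def UniformlyConsistent {d : ℕ} (T : ℝ → (Euc d → ℝ) → Euc d → ℝ)
    (G : (Euc d → ℝ) → Euc d → ℝ) (𝒲 : Set (Euc d → ℝ)) : Prop :=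
  ∀ e > 0, ∀ᶠ s in 𝓝[>] (0 : ℝ), ∀ w ∈ 𝒲, ∀ x, |T s w x - w x - s * G w x| ≤ s * e

/-- Nothing is known about `G` except consistency, so it is bounded by reading it off at a single
admissible time `s`: `s G w` is within `s` of `T_s w - w`, which is at most `2C`. -/
theorem UniformlyConsistent.exists_bound {d : ℕ} {T : ℝ → (Euc d → ℝ) → Euc d → ℝ}
    {G : (Euc d → ℝ) → Euc d → ℝ} {𝒲 : Set (Euc d → ℝ)} (hT : ∀ s, IsSublinearOp (T s))
    (h𝒲 : UniformlyConsistent T G 𝒲) {C K : ℝ} (hC : 0 ≤ C) (hw : ∀ w ∈ 𝒲, BddLipWith C K w) :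
    ∃ M, 0 ≤ M ∧ ∀ w ∈ 𝒲, ∀ x, |G w x| ≤ M := by
  obtain ⟨s, hs, hs0⟩ := ((h𝒲 1 one_pos).and self_mem_nhdsWithin).exists
  have hs0 : 0 < s := hs0
  refine ⟨2 * C / s + 1, by positivity, fun w hwm x => ?_⟩
  have h1 := abs_le.1 (hs w hwm x)
  have h2 := abs_le.1 (((hT s).bddLipWith (hw w hwm)).1 x)
  have h3 := abs_le.1 ((hw w hwm).1 x)
  have h4 : s * (2 * C / s + 1) = 2 * C + s := by field_simp
  refine abs_le.2 ⟨?_, ?_⟩ <;> refine le_of_mul_le_mul_left ?_ hs0 <;> nlinarith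

/-! ### Short time behaviour of the iterates -/

namespace IsChernoffFamily

variable {d : ℕ} {α : ℝ} {T : ℝ → (Euc d → ℝ) → Euc d → ℝ} {G : (Euc d → ℝ) → Euc d → ℝ}

theorem uniformlyConsistent_singleton (hT : IsChernoffFamily α T G) {φ : Euc d → ℝ}
    (hφ : IsCb3 φ) : UniformlyConsistent T G {φ} := by
  intro e he
  filter_upwards [hT.consistent φ hφ e he] with s hs w hw
  rw [mem_singleton_iff.1 hw]
  exact hs

theorem exists_rate (hT : IsChernoffFamily α T G) {φ : Euc d → ℝ} (hφ : IsCb3 φ) :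
    ∃ M, 0 ≤ M ∧ ∀ᶠ s in 𝓝[>] (0 : ℝ), ∀ x, |T s φ x - φ x| ≤ s * M := by
  obtain ⟨C, K, hC, hK, h⟩ := hφ.bddLip.exists_with
  obtain ⟨M, hM, hG⟩ := (hT.uniformlyConsistent_singleton hφ).exists_bound hT.op hC
    (fun w hw => by rw [mem_singleton_iff.1 hw]; exact h)
  refine ⟨M + 1, by positivity, ?_⟩
  filter_upwards [hT.consistent φ hφ 1 one_pos, self_mem_nhdsWithin] with s hs hs0 x
  have hs0 : 0 < s := hs0
  have h1 := abs_le.1 (hs x)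
  have h2 := abs_le.1 (hG φ rfl x)
  exact abs_le.2 ⟨by nlinarith, by nlinarith⟩

/-- Sublinearity gives homogeneity only for `c ≥ 0`; negative `c` use the rate of `-φ`. The point is
that one threshold in `s` serves all `c`. -/
theorem exists_rate_const_mul (hT : IsChernoffFamily α T G) {φ : Euc d → ℝ} (hφ : IsCb3 φ) :
    ∃ M, 0 ≤ M ∧ ∀ᶠ s in 𝓝[>] (0 : ℝ), ∀ (c : ℝ) (x : Euc d),
      T s (fun y => c * φ y) x - c * φ x ≤ |c| * (s * M) := by
  obtain ⟨M, hM, h⟩ := hT.exists_rate hφ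
  obtain ⟨M', hM', h'⟩ := hT.exists_rate hφ.neg
  refine ⟨max M M', le_max_of_le_left hM, ?_⟩
  filter_upwards [h, h', self_mem_nhdsWithin] with s hs hs' hs0 c x
  have hs0 : 0 < s := hs0
  rcases le_total 0 c with hc | hc
  · rw [(hT.op s).const_mul hc hφ.bddLip, abs_of_nonneg hc, ← mul_sub]
    refine mul_le_mul_of_nonneg_left ((le_abs_self _).trans ((hs x).trans ?_)) hc
    exact mul_le_mul_of_nonneg_left (le_max_left _ _) hs0.le
  · have h1 : (fun y => c * φ y) = fun y => (-c) * (- φ y) := by ext y; ring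
    rw [h1, (hT.op s).const_mul (neg_nonneg.2 hc) hφ.neg.bddLip, abs_of_nonpos hc]
    have h2 : -c * T s (fun y => - φ y) x - c * φ x = -c * (T s (fun y => - φ y) x - - φ x) := by
      ring
    rw [h2]
    refine mul_le_mul_of_nonneg_left ((le_abs_self _).trans ((hs' x).trans ?_))
      (neg_nonneg.2 hc)
    exact mul_le_mul_of_nonneg_left (le_max_right _ _) hs0.le

/-- Iterates of the family over a short total time are close to the identity. -/
theorem exists_time_abs_iterate_sub_le (hT : IsChernoffFamily α T G) {C K e : ℝ} (hC : 0 ≤ C)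
    (hK : 0 ≤ K) (he : 0 < e) :
    ∃ τ > (0 : ℝ), ∀ᶠ h in 𝓝[>] (0 : ℝ), ∀ k : ℕ, (k : ℝ) * h ≤ τ → ∀ f, BddLipWith C K f → ∀ x,
      |(T h)^[k] f x - f x| ≤ e := by
  obtain ⟨ψ, hψ, hψ0, hψle⟩ := exists_isCb3_min_sq_le d
  obtain ⟨M, hM, hrate⟩ := hT.exists_rate hψ
  set r : ℝ := e / (2 * (K + 1)) with hr
  have hr0 : 0 < r := by positivity
  set A : ℝ := 2 * C / min (r ^ 2) 1 with hA
  have hm0 : 0 < min (r ^ 2) 1 := by positivity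
  have hA0 : 0 ≤ A := by positivity
  have hψnn : ∀ x, 0 ≤ ψ x := fun x => le_trans (by positivity) (hψle x)
  -- Tightness: within distance `r` the Lipschitz bound costs at most `e / 2`, and beyond it the
  -- oscillation `2C` is absorbed by `A ψ`. It remains to see that iterates increase `ψ(0) = 0` by
  -- at most `k h M`.
  have hptw : ∀ f, BddLipWith C K f → ∀ x y, |f y - f x| ≤ A * ψ (y - x) + e / 2 := by
    intro f hf x y
    rcases le_total ‖y - x‖ r with hyx | hyx
    · have h1 := hf.2 y x
      rw [dist_eq_norm] at h1
      have h2 : K * ‖y - x‖ ≤ K * r := mul_le_mul_of_nonneg_left hyx hK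
      have h3 : K * r ≤ e / 2 := by
        rw [hr, mul_div_assoc', div_le_div_iff₀ (by positivity) two_pos]
        nlinarith
      have h4 := mul_nonneg hA0 (hψnn (y - x))
      linarith
    · have h1 : min (r ^ 2) 1 ≤ ψ (y - x) := by
        refine le_trans (min_le_min_right _ ?_) (hψle _)
        gcongr
      have h2 : A * min (r ^ 2) 1 = 2 * C := by rw [hA]; field_simp
      have h3 := mul_le_mul_of_nonneg_left h1 hA0
      have h4 := abs_sub (f y) (f x)
      linarith [hf.1 y, hf.1 x]
  refine ⟨e / (2 * (A * M + 1)), by positivity, ?_⟩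
  filter_upwards [hrate, self_mem_nhdsWithin] with h hh h0 k hk f hf x
  have h0 : 0 < h := h0
  have hψk : ∀ k : ℕ, ∀ x, (T h)^[k] ψ x ≤ ψ x + k * (h * M) := by
    intro k
    induction k with
    | zero => intro x; simp
    | succ k ih =>
      intro x
      have hop := (hT.op h).iterate k
      rw [Function.iterate_succ_apply]
      have h1 := hop.le_add_const ((hT.op h).bddLip hψ.bddLip) hψ.bddLip (c := h * M)
        (fun y => by linarith [le_abs_self (T h ψ y - ψ y), hh y]) x
      push_cast
      linarith [ih x]
  have hop := (hT.op h).iterate k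
  have htr := hop.translate ψ (-x) x
  simp only [← sub_eq_add_neg, sub_self] at htr
  have hψx : BddLip fun y => A * ψ (y - x) := by
    have := (hψ.bddLip.comp_add_right (-x)).const_mul A
    simpa only [← sub_eq_add_neg] using this
  have hbd : A * (T h)^[k] ψ 0 ≤ e / 2 := by
    have h1 := hψk k 0
    rw [hψ0, zero_add] at h1
    have h2 : A * (T h)^[k] ψ 0 ≤ A * (k * (h * M)) := mul_le_mul_of_nonneg_left h1 hA0
    have h3 : A * (k * (h * M)) = (A * M) * (k * h) := by ring
    have h4 : (A * M) * (k * h) ≤ (A * M) * (e / (2 * (A * M + 1))) :=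
      mul_le_mul_of_nonneg_left hk (by positivity)
    have h5 : (A * M) * (e / (2 * (A * M + 1))) ≤ e / 2 := by
      rw [mul_div_assoc', div_le_div_iff₀ (by positivity) two_pos]
      nlinarith [mul_nonneg hA0 hM]
    linarith
  have hAψ : (T h)^[k] (fun y => A * ψ (y - x)) x = A * (T h)^[k] ψ 0 := by
    have := hop.const_mul hA0 (hψ.bddLip.comp_add_right (-x)) x
    simp only [← sub_eq_add_neg] at this
    rw [this, htr]
  have up := hop.le_add_const hf.bddLip hψx (c := f x + e / 2)
    (fun y => by linarith [le_abs_self (f y - f x), hptw f hf x y]) x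
  have dn := hop.le_add_add_const (bddLip_const (f x)) hf.bddLip hψx (c := e / 2)
    (fun y => by linarith [neg_abs_le (f y - f x), hptw f hf x y]) x
  rw [hop.const] at dn
  rw [hAψ] at up dn
  exact abs_le.2 ⟨by linarith, by linarith⟩

/-- First order expansion of iterates over a short total time. -/
theorem exists_time_abs_iterate_sub_sub_le (hT : IsChernoffFamily α T G) {𝒲 : Set (Euc d → ℝ)}
    (h𝒲 : UniformlyConsistent T G 𝒲) {C K e : ℝ} (hC : 0 ≤ C) (hK : 0 ≤ K)
    (hw : ∀ w ∈ 𝒲, BddLipWith C K w) (he : 0 < e) :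
    ∃ τ > (0 : ℝ), ∀ᶠ h in 𝓝[>] (0 : ℝ), ∀ k : ℕ, (k : ℝ) * h ≤ τ → ∀ w ∈ 𝒲, ∀ x,
      |(T h)^[k] w x - w x - k * h * G w x| ≤ k * h * e := by
  have he5 : 0 < e / 5 := by positivity
  obtain ⟨σ, hσ, hσ0⟩ := ((h𝒲 (e / 5) he5).and self_mem_nhdsWithin).exists
  have hσ0 : 0 < σ := hσ0
  obtain ⟨τ, hτ, hB⟩ := hT.exists_time_abs_iterate_sub_le (C := σ⁻¹ * (C + C)) (K := σ⁻¹ * (K + K))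
    (by positivity) (by positivity) he5
  refine ⟨τ, hτ, ?_⟩
  filter_upwards [hB, h𝒲 (e / 5) he5, self_mem_nhdsWithin] with h hB hcons h0 k hk w hwm
  have h0 : 0 < h := h0
  have hwL := hw w hwm
  -- `G w` need not be known to be Lipschitz, so it is replaced by the difference quotient at one
  -- fixed time `σ`. This is uniformly close to `G w` and bounded Lipschitz with constants common to
  -- all `w`, so iterates over a short time barely move it.
  set g : Euc d → ℝ := fun y => σ⁻¹ * (T σ w y - w y) with hg
  have hgL : BddLipWith (σ⁻¹ * (C + C)) (σ⁻¹ * (K + K)) g := by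
    have := (((hT.op σ).bddLipWith hwL).sub hwL).const_mul σ⁻¹
    rwa [abs_of_pos (inv_pos.2 hσ0)] at this
  have hgG : ∀ y, |g y - G w y| ≤ e / 5 := by
    intro y
    have h1 : g y - G w y = σ⁻¹ * (T σ w y - w y - σ * G w y) := by
      rw [hg]; field_simp
    rw [h1, abs_mul, abs_of_pos (inv_pos.2 hσ0), inv_mul_le_iff₀ hσ0]
    exact hσ w hwm y
  induction k with
  | zero => intro x; simp
  | succ k ih =>
    intro x
    push_cast at hk ⊢
    have hk' : k * h ≤ τ := by nlinarith
    have ih := abs_le.1 (ih hk' x)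
    have hop := (hT.op h).iterate k
    -- The innermost step is peeled off, so that consistency is used at `w` itself and never at an
    -- iterate.
    rw [Function.iterate_succ_apply]
    have hgn := hgL.neg
    have hstep : ∀ y, |T h w y - w y - h * g y| ≤ h * (2 * e / 5) := by
      intro y
      have h1 := abs_le.1 (hcons w hwm y)
      have h2 := abs_le.1 (hgG y)
      exact abs_le.2 ⟨by nlinarith, by nlinarith⟩
    have up := hop.le_add_add_const ((hT.op h).bddLip hwL.bddLip) hwL.bddLip
      (hgL.bddLip.const_mul h) (c := h * (2 * e / 5))
      (fun y => by linarith [(abs_le.1 (hstep y)).2]) x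
    -- Subadditivity gives only upper bounds; the lower one comes from `w ≤ T_h w + h (-g) + error`,
    -- which is why `-g` is also carried through the iterates.
    have dn := hop.le_add_add_const hwL.bddLip ((hT.op h).bddLip hwL.bddLip)
      (hgn.bddLip.const_mul h) (c := h * (2 * e / 5))
      (fun y => by linarith [(abs_le.1 (hstep y)).1]) x
    rw [hop.const_mul h0.le hgL.bddLip] at up
    rw [hop.const_mul h0.le hgn.bddLip] at dn
    have b1 := abs_le.1 (hB k hk' g hgL x)
    have b2 := abs_le.1 (hB k hk' _ hgn x)
    have b3 := abs_le.1 (hgG x)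
    have u1 : h * (T h)^[k] g x ≤ h * (G w x + 2 * e / 5) :=
      mul_le_mul_of_nonneg_left (by linarith) h0.le
    have u2 : h * (T h)^[k] (fun y => - g y) x ≤ h * (- G w x + 2 * e / 5) :=
      mul_le_mul_of_nonneg_left (by linarith) h0.le
    have hhe : 0 < h * e := by positivity
    exact abs_le.2 ⟨by linarith, by linarith⟩

end IsChernoffFamily

/-! ### Compactness and uniform consistency on mollified functions -/

/-- Bounded Lipschitz functions have finite nets for uniform convergence on balls. -/
theorem exists_finite_net_bddLipWith (d : ℕ) (C K R : ℝ) {e : ℝ} (he : 0 < e) :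
    ∃ S : Set (Euc d → ℝ), S.Finite ∧ (∀ v ∈ S, BddLipWith C K v) ∧
      ∀ w, BddLipWith C K w → ∃ v ∈ S, ∀ z, ‖z‖ ≤ R → |w z - v z| ≤ e := by
  classical
  let B := Metric.closedBall (0 : Euc d) R
  have : CompactSpace B := isCompact_iff_compactSpace.1 (isCompact_closedBall _ _)
  let A : Set (BoundedContinuousFunction B ℝ) :=
    {u | ∃ w : Euc d → ℝ, BddLipWith C K w ∧ ∀ z : B, u z = w z}
  have hcomp : IsCompact (closure A) := by
    refine BoundedContinuousFunction.arzela_ascoli (Icc (-C) C) isCompact_Icc A ?_ ?_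
    · rintro u z ⟨w, hw, huw⟩
      rw [huw]
      exact abs_le.1 (hw.1 _)
    · refine UniformEquicontinuous.equicontinuous ?_
      refine LipschitzWith.uniformEquicontinuous _ K.toNNReal fun u => ?_
      obtain ⟨u, w, hw, huw⟩ := u
      refine LipschitzWith.of_dist_le_mul fun x y => ?_
      change dist (u x) (u y) ≤ _
      rw [huw, huw, Real.dist_eq]
      exact (hw.2 x y).trans (mul_le_mul_of_nonneg_right (Real.le_coe_toNNReal K) dist_nonneg)
  obtain ⟨N, hNA, hNfin, hcov⟩ := Metric.finite_approx_of_totallyBounded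
    (hcomp.totallyBounded.subset subset_closure) e he
  -- Arzelà–Ascoli works with restrictions to the ball; each net element is replaced by a function
  -- on the whole space with the same constants.
  choose! ext hext using fun (u : BoundedContinuousFunction B ℝ) (hu : u ∈ A) => hu
  refine ⟨ext '' N, hNfin.image _, ?_, fun w hw => ?_⟩
  · rintro _ ⟨u, hu, rfl⟩
    exact (hext u (hNA hu)).1
  · let u : BoundedContinuousFunction B ℝ := BoundedContinuousFunction.mkOfCompact
      ⟨fun z => w z, hw.continuous.comp continuous_subtype_val⟩
    have huA : u ∈ A := ⟨w, hw, fun z => rfl⟩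
    obtain ⟨v, hv, hd⟩ := mem_iUnion₂.1 (hcov huA)
    refine ⟨ext v, mem_image_of_mem _ hv, fun z hz => ?_⟩
    have hzB : z ∈ B := by simpa [B] using hz
    have h1 := (hext v (hNA hv)).2 ⟨z, hzB⟩
    have h2 : u ⟨z, hzB⟩ = w z := rfl
    rw [← h2, ← h1, ← Real.dist_eq]
    exact (BoundedContinuousFunction.dist_coe_le_dist _).trans (Metric.mem_ball.1 hd).le

namespace IsChernoffFamily

variable {d : ℕ} {α : ℝ} {T : ℝ → (Euc d → ℝ) → Euc d → ℝ} {G : (Euc d → ℝ) → Euc d → ℝ}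

/-- Far away values contribute little to the rate of change of `T s` at `0`. -/
theorem exists_tail_le (hT : IsChernoffFamily α T G) {ψ : Euc d → ℝ} (hψ : IsCb3 ψ)
    (hψ0 : ψ 0 = 0) {e : ℝ} (he : 0 < e) :
    ∃ R : ℝ, 0 < R ∧ ∀ᶠ s in 𝓝[>] (0 : ℝ), T s (fun y => ψ (R⁻¹ • y)) 0 ≤ s * e := by
  obtain ⟨M, hM, hrate⟩ := hT.exists_rate hψ
  -- With `R ^ α = b`, dilating by `R` divides the time by `b`, so the rate `M` of `ψ` drops to `M /
  -- b ≤ e`.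
  set b : ℝ := M / e + 1 with hb
  have hb0 : 0 < b := by positivity
  set R : ℝ := b ^ (1 / α) with hR
  have hR0 : 0 < R := Real.rpow_pos_of_pos hb0 _
  have hRα : R ^ (-α) = b⁻¹ := by
    rw [hR, ← Real.rpow_mul hb0.le, ← Real.rpow_neg_one]
    congr 1
    have := hT.pos.ne'
    field_simp
  refine ⟨R, hR0, ?_⟩
  obtain ⟨s0, hs0, hs⟩ := mem_nhdsGT_iff_exists_Ioo_subset.1 hrate
  filter_upwards [Ioo_mem_nhdsGT hs0] with s hs'
  have hb1 : b⁻¹ ≤ 1 := inv_le_one_of_one_le₀ (by rw [hb]; linarith [show 0 ≤ M / e by positivity])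
  have hmem : s * R ^ (-α) ∈ Ioo 0 s0 := by
    rw [hRα]
    exact ⟨mul_pos hs'.1 (inv_pos.2 hb0), lt_of_le_of_lt (by nlinarith [hs'.1]) hs'.2⟩
  have h1 := hs hmem (0 : Euc d)
  rw [hψ0, sub_zero] at h1
  rw [hT.scale s R hs'.1 hR0]
  refine (le_abs_self _).trans (h1.trans ?_)
  rw [hRα, mul_assoc]
  refine mul_le_mul_of_nonneg_left ?_ hs'.1.le
  rw [inv_mul_le_iff₀ hb0, hb, add_mul, div_mul_cancel₀ _ he.ne']
  linarith

/-- The rate of change of `T s` at `0` is small on mollifications of functions which are small on a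
large ball. -/
theorem exists_ball_mollify_le (hT : IsChernoffFamily α T G) (ρ : ContDiffBump (0 : Euc d))
    {C e : ℝ} (hC : 0 ≤ C) (he : 0 < e) :
    ∃ R κ : ℝ, 0 < κ ∧ ∀ᶠ s in 𝓝[>] (0 : ℝ), ∀ (K : ℝ) (u : Euc d → ℝ), BddLipWith C K u →
      (∀ z, ‖z‖ ≤ R → |u z| ≤ κ) → T s (mollify ρ u) 0 - mollify ρ u 0 ≤ s * e := by
  obtain ⟨ψ, hψ, hψ0, hψle⟩ := exists_isCb3_min_sq_le d
  have hψnn : ∀ x, 0 ≤ ψ x := fun x => le_trans (by positivity) (hψle x)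
  obtain ⟨R₀, hR₀, htail⟩ := hT.exists_tail_le hψ hψ0 (e := e / (2 * (C + 1))) (by positivity)
  obtain ⟨M, hM, hrate⟩ := hT.exists_rate_const_mul (isCb3_normed ρ)
  obtain ⟨Cρ, Kρ, hCρ, hKρ, hρ⟩ := (isCb3_normed ρ).bddLip.exists_with
  -- Outside the ball of radius `R` the weight `ρ(-z)` vanishes, and so does `ρ(y - z)` when `‖y‖ ≤
  -- R₀`.
  set R : ℝ := R₀ + ρ.rOut with hR
  set B : Set (Euc d) := Metric.closedBall 0 R with hB
  have hBm : MeasurableSet B := Metric.isClosed_closedBall.measurableSet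
  have hBfin : IsFiniteMeasure (volume.restrict B) :=
    ⟨by simpa using! (isCompact_closedBall (0 : Euc d) R).measure_lt_top⟩
  set m : ℝ := (volume.restrict B).real univ with hm
  have hm0 : 0 ≤ m := measureReal_nonneg
  set κ : ℝ := e / (2 * (m * M + 1)) with hκ
  have hκ0 : 0 < κ := by positivity
  have hρ0 : ∀ z : Euc d, ρ.rOut ≤ ‖z‖ → ρ.normed volume z = 0 := fun z hz => by
    rw [← Function.notMem_support, ρ.support_normed_eq]
    simpa using hz
  refine ⟨R, κ, hκ0, ?_⟩
  filter_upwards [htail, hrate, self_mem_nhdsWithin] with s htail hrate hs K u hu hsmall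
  have hs : 0 < s := hs
  have hop := hT.op s
  set ρn : Euc d → ℝ := ρ.normed volume with hρn
  -- The part of `ρ * u - (ρ * u)(0)` coming from small values of `u`: an integral of translates of
  -- `ρ` with coefficients at most `κ`, each of rate at most `κ M` by `exists_rate_const_mul`.
  -- Neither `κ` nor the threshold in `s` depends on the Lipschitz constant of `u`.
  set v : Euc d → ℝ := fun y => ∫ z in B, u z * (ρn (y - z) - ρn (-z)) with hv
  have hρz : ∀ z, BddLipWith (2 * Cρ) Kρ (fun y => ρn (y - z) - ρn (-z)) := fun z => by
    have h1 : BddLipWith Cρ Kρ (fun y => ρn (y - z)) := by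
      simpa only [← sub_eq_add_neg] using hρ.comp_add_right (-z)
    refine (h1.sub ((bddLipWith_const (ρn (-z))).mono (hρ.1 _) le_rfl)).mono ?_ ?_ <;> linarith
  have hF : ∀ z, BddLipWith (C * (2 * Cρ)) (C * Kρ) (fun y => u z * (ρn (y - z) - ρn (-z))) :=
    fun z => ((hρz z).const_mul _).mono (mul_le_mul_of_nonneg_right (hu.1 z) (by positivity))
      (mul_le_mul_of_nonneg_right (hu.1 z) hKρ)
  have hFz : ∀ z z' y, |u z * (ρn (y - z) - ρn (-z)) - u z' * (ρn (y - z') - ρn (-z'))|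
      ≤ (K * (2 * Cρ) + C * (2 * Kρ)) * dist z z' := fun z z' y => by
    have e1 : u z * (ρn (y - z) - ρn (-z)) - u z' * (ρn (y - z') - ρn (-z'))
        = (u z - u z') * (ρn (y - z) - ρn (-z))
          + u z' * ((ρn (y - z) - ρn (y - z')) - (ρn (-z) - ρn (-z'))) := by ring
    have e2 := hρ.2 (y - z) (y - z')
    have e3 := hρ.2 (-z) (-z')
    rw [dist_sub_left] at e2
    rw [dist_neg_neg] at e3
    have e4 : |(ρn (y - z) - ρn (y - z')) - (ρn (-z) - ρn (-z'))| ≤ 2 * Kρ * dist z z' :=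
      (abs_sub _ _).trans (by linarith)
    rw [e1]
    refine (abs_add_le _ _).trans ?_
    rw [abs_mul, abs_mul]
    have e5 := (abs_nonneg _).trans (hu.2 z z')
    calc _ ≤ K * dist z z' * (2 * Cρ) + C * (2 * Kρ * dist z z') := by
          gcongr
          · exact hu.2 z z'
          · exact (hρz z).1 y
          · exact hu.1 z'
      _ = _ := by ring
  have hint : ∀ y, Integrable (fun z => u z * (ρn (y - z) - ρn (-z))) (volume : Measure (Euc d)) := by
    intro y
    have h2 := (integrable_mul_normed ρ hu.continuous y).sub
      (integrable_mul_normed ρ hu.continuous 0)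
    refine h2.congr (ae_of_all _ fun z => ?_)
    simp [mul_sub, hρn]
  have hvb : T s v 0 ≤ s * (e / 2) := by
    have key := hop.apply_integral_le (volume.restrict B)
      (F := fun z y => u z * (ρn (y - z) - ρn (-z))) (b := κ * (s * M)) (x := 0) hF hFz
      (ae_restrict_of_forall_mem hBm fun z hz => by
        have h1 := hrate (u z) (-z)
        have h2 : BddLip (fun y => u z * ρn y) := hρ.bddLip.const_mul _
        have h3 := hop.translate (fun y => u z * ρn y) (-z) 0
        simp only [← sub_eq_add_neg, zero_sub] at h3
        have h4 : BddLip (fun y => u z * ρn (y - z)) := by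
          simpa only [← sub_eq_add_neg] using h2.comp_add_right (-z)
        have h5 := hop.le_add_const (hF z).bddLip h4 (c := - (u z * ρn (-z)))
          (fun y => by linarith) 0
        have h6 : |u z| * (s * M) ≤ κ * (s * M) :=
          mul_le_mul_of_nonneg_right (hsmall z (by simpa [hB] using hz)) (by positivity)
        linarith)
    refine key.trans ?_
    have h1 : m * (κ * (s * M)) = s * (m * M * κ) := by ring
    rw [h1]
    refine mul_le_mul_of_nonneg_left ?_ hs.le
    rw [hκ, mul_div_assoc', div_le_div_iff₀ (by positivity) two_pos]
    nlinarith [mul_nonneg hm0 hM]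
  have hvBL : BddLip v := by
    have h1 : BddLipWith (m * (C * (2 * Cρ))) (m * (C * Kρ)) v := by
      refine ⟨fun y => ?_, fun y y' => ?_⟩
      · rw [← Real.norm_eq_abs, mul_comm]
        have := norm_setIntegral_le_of_norm_le_const (μ := (volume : Measure (Euc d))) (s := B)
          (f := fun z => u z * (ρn (y - z) - ρn (-z))) (C := C * (2 * Cρ))
          (isCompact_closedBall (0 : Euc d) R).measure_lt_top (fun z _ => (hF z).1 y)
        simpa [hm, measureReal_def] using this
      · have h2 : v y - v y' = ∫ z in B, (u z * (ρn (y - z) - ρn (-z))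
            - u z * (ρn (y' - z) - ρn (-z))) :=
          (integral_sub (hint y).integrableOn (hint y').integrableOn).symm
        rw [h2, ← Real.norm_eq_abs]
        have := norm_setIntegral_le_of_norm_le_const (μ := (volume : Measure (Euc d))) (s := B)
          (f := fun z => u z * (ρn (y - z) - ρn (-z)) - u z * (ρn (y' - z) - ρn (-z)))
          (C := C * Kρ * dist y y')
          (isCompact_closedBall (0 : Euc d) R).measure_lt_top (fun z _ => (hF z).2 y y')
        refine this.trans (le_of_eq ?_)
        simp [hm, measureReal_def]
        ring
    exact h1.bddLip
  have hψR : BddLip (fun y : Euc d => ψ (R₀⁻¹ • y)) :=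
    hψ.bddLip.comp (lipschitzWith_smul (R₀⁻¹))
  -- The part of the integral outside the ball vanishes for `‖y‖ ≤ R₀` and is at most `C` otherwise,
  -- hence is dominated by the dilate of `ψ`, whose rate is small.
  have hptw : ∀ y, mollify ρ u y ≤ v y + C * ψ (R₀⁻¹ • y) + mollify ρ u 0 := by
    intro y
    have h1 : mollify ρ u y - mollify ρ u 0 = ∫ z, u z * (ρn (y - z) - ρn (-z)) := by
      rw [mollify_eq, mollify_eq, ← integral_sub (integrable_mul_normed ρ hu.continuous y)
        (integrable_mul_normed ρ hu.continuous 0)]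
      simp [mul_sub, hρn]
    have h2 := integral_add_compl hBm (hint y)
    have h3 : ∫ z in Bᶜ, u z * (ρn (y - z) - ρn (-z)) ≤ C * ψ (R₀⁻¹ • y) := by
      have h4 : ∀ z ∈ Bᶜ, u z * (ρn (y - z) - ρn (-z)) = u z * ρn (y - z) := fun z hz => by
        have : R < ‖z‖ := by simpa [hB] using hz
        rw [hρ0 (-z) (by rw [norm_neg]; linarith), sub_zero]
      rw [setIntegral_congr_fun hBm.compl h4]
      rcases le_total ‖y‖ R₀ with hy | hy
      · have h5 : ∀ z ∈ Bᶜ, u z * ρn (y - z) = 0 := fun z hz => by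
          have h6 : R < ‖z‖ := by simpa [hB] using hz
          have h7 := norm_sub_norm_le z y
          rw [norm_sub_rev] at h7
          rw [hρ0 (y - z) (by linarith), mul_zero]
        rw [setIntegral_congr_fun hBm.compl h5]
        simpa using mul_nonneg hC (hψnn _)
      · have h5 : 1 ≤ ψ (R₀⁻¹ • y) := by
          refine le_trans ?_ (hψle _)
          have : 1 ≤ ‖R₀⁻¹ • y‖ := by
            rw [norm_smul, norm_inv, Real.norm_of_nonneg hR₀.le, ← div_eq_inv_mul, one_le_div hR₀]
            exact hy
          exact le_min (one_le_pow₀ this) le_rfl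
        have hρi : Integrable (fun z => ρn (y - z)) (volume : Measure (Euc d)) :=
          ρ.integrable_normed.comp_sub_left y
        have h6 : ∫ z in Bᶜ, u z * ρn (y - z) ≤ ∫ z in Bᶜ, C * ρn (y - z) := by
          refine setIntegral_mono (integrable_mul_normed ρ hu.continuous y).integrableOn
            (hρi.const_mul C).integrableOn fun z => ?_
          exact mul_le_mul_of_nonneg_right ((le_abs_self _).trans (hu.1 z)) (ρ.nonneg_normed _)
        have h7 : ∫ z in Bᶜ, C * ρn (y - z) ≤ ∫ z, C * ρn (y - z) :=
          setIntegral_le_integral (hρi.const_mul C)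
            (ae_of_all _ fun z => mul_nonneg hC (ρ.nonneg_normed _))
        have h8 : ∫ z, C * ρn (y - z) = C := by
          rw [integral_const_mul, integral_sub_left_eq_self (fun z => ρn z) volume y,
            hρn, ρ.integral_normed, mul_one]
        nlinarith
    have h4 : v y = ∫ z in B, u z * (ρn (y - z) - ρn (-z)) := rfl
    linarith
  have hfin := hop.le_add_add_const (hu.mollify ρ).bddLip hvBL (hψR.const_mul C) hptw 0
  rw [hop.const_mul hC hψR] at hfin
  have h9 : C * T s (fun y => ψ (R₀⁻¹ • y)) 0 ≤ s * (e / 2) := by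
    refine (mul_le_mul_of_nonneg_left htail hC).trans ?_
    have h1 : C * (s * (e / (2 * (C + 1)))) = s * (C * (e / (2 * (C + 1)))) := by ring
    rw [h1]
    refine mul_le_mul_of_nonneg_left ?_ hs.le
    rw [mul_div_assoc', div_le_div_iff₀ (by positivity) two_pos]
    nlinarith
  linarith

/-- Translation reduces to the origin. There, replacing `w` by a net element close to it on a large
ball changes the rate of `ρ * w` by little (`exists_ball_mollify_le`), and consistency is needed
only for the finitely many net elements. -/
theorem uniformlyConsistent_mollify (hT : IsChernoffFamily α T G) (ρ : ContDiffBump (0 : Euc d))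
    {C : ℝ} (K : ℝ) (hC : 0 ≤ C) :
    UniformlyConsistent T G (mollify ρ '' {w | BddLipWith C K w}) := by
  intro e he
  obtain ⟨R, κ, hκ, hball⟩ := hT.exists_ball_mollify_le ρ (C := C + C) (e := e / 8)
    (by positivity) (by positivity)
  obtain ⟨S, hSfin, hS, hnet⟩ := exists_finite_net_bddLipWith d C K R hκ
  have hSc : ∀ᶠ s in 𝓝[>] (0 : ℝ), ∀ v ∈ S,
      |T s (mollify ρ v) 0 - mollify ρ v 0 - s * G (mollify ρ v) 0| ≤ s * (e / 8) := by
    refine (eventually_all_finite hSfin).2 fun v hv => ?_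
    exact (hT.consistent _ (isCb3_mollify ρ (hS v hv).bddLip) (e / 8) (by positivity)).mono
      fun s hs => hs 0
  have hnear : ∀ᶠ s in 𝓝[>] (0 : ℝ), ∀ w, BddLipWith C K w → ∀ v ∈ S,
      (∀ z, ‖z‖ ≤ R → |w z - v z| ≤ κ) →
      |T s (mollify ρ w) 0 - mollify ρ w 0 - s * G (mollify ρ v) 0| ≤ s * (e / 4) := by
    filter_upwards [hball, hSc] with s hball hSc w hw v hv hwv
    have hop := hT.op s
    have hvL := hS v hv
    have hcmp : ∀ w v : Euc d → ℝ, BddLipWith C K w → BddLipWith C K v →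
        (∀ z, ‖z‖ ≤ R → |w z - v z| ≤ κ) →
        T s (mollify ρ w) 0 - mollify ρ w 0 ≤ T s (mollify ρ v) 0 - mollify ρ v 0 + s * (e / 8) := by
      intro w v hw hv hwv
      have h1 := hball _ _ (hw.sub hv) hwv
      have h2 := hop.le_add (hw.mollify ρ).bddLip (hv.mollify ρ).bddLip
        ((hw.sub hv).mollify ρ).bddLip
        (fun x => by rw [mollify_sub ρ hw.continuous hv.continuous]; linarith) 0
      rw [mollify_sub ρ hw.continuous hv.continuous 0] at h1
      linarith
    have h1 := hcmp w v hw hvL hwv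
    have h2 := hcmp v w hvL hw (fun z hz => by rw [abs_sub_comm]; exact hwv z hz)
    have h3 := abs_le.1 (hSc v hv)
    exact abs_le.2 ⟨by linarith, by linarith⟩
  filter_upwards [hnear, self_mem_nhdsWithin] with s hs hs0
  have hs0 : 0 < s := hs0
  rintro _ ⟨w, hw, rfl⟩ x
  have hw : BddLipWith C K w := hw
  obtain ⟨v, hv, hwv⟩ := hnet _ (hw.comp_add_right x)
  have hmx : mollify ρ (fun y => w (y + x)) = fun y => mollify ρ w (y + x) := by
    ext y
    refine integral_congr_ae (ae_of_all _ fun z => ?_)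
    simp only
    congr 2
    abel
  have hsx : ∀ s, T s (mollify ρ fun y => w (y + x)) 0 = T s (mollify ρ w) x := fun s => by
    rw [hmx, (hT.op s).translate, zero_add]
  have hm0 : mollify ρ (fun y => w (y + x)) 0 = mollify ρ w x := by simp only [hmx, zero_add]
  have hs1 := hs _ (hw.comp_add_right x) v hv hwv
  rw [hsx, hm0] at hs1
  -- To compare `G (ρ * w)` at `x` with `G (ρ * v)` at `0`, both are read off at a common time `r`.
  -- This time may depend on `w`, but after division by `r` the resulting bound does not.
  obtain ⟨r, ⟨hr, hr'⟩, hr0⟩ := ((hnear.and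
    (hT.consistent _ (isCb3_mollify ρ hw.bddLip) (e / 8) (by positivity))).and
    self_mem_nhdsWithin).exists
  have hr0 : 0 < r := hr0
  have hr1 := hr _ (hw.comp_add_right x) v hv hwv
  rw [hsx, hm0] at hr1
  have hr2 := hr' x
  have hG : |G (mollify ρ w) x - G (mollify ρ v) 0| ≤ 3 * e / 8 := by
    have a1 := abs_le.1 hr1
    have a2 := abs_le.1 hr2
    refine abs_le.2 ⟨?_, ?_⟩ <;> refine le_of_mul_le_mul_left ?_ hr0 <;> linarith
  have a1 := abs_le.1 hs1
  have a2 := abs_le.1 hG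
  exact abs_le.2 ⟨by nlinarith, by nlinarith⟩

end IsChernoffFamily

/-! ### The Cauchy estimate for the discretizations -/

namespace IsChernoffFamily

variable {d : ℕ} {α : ℝ} {T : ℝ → (Euc d → ℝ) → Euc d → ℝ} {G : (Euc d → ℝ) → Euc d → ℝ}

/-- Comparison of two discretizations with the same number of blocks. -/
theorem iterate_le_iterate_add (hT : IsChernoffFamily α T G) (ρ : ContDiffBump (0 : Euc d))
    {C K M e τ h h' : ℝ} {q q' : ℕ} (hK : 0 ≤ K)
    (hM : ∀ w, BddLipWith C K w → ∀ x, |G (mollify ρ w) x| ≤ M)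
    (hq : ∀ w, BddLipWith C K w → ∀ x,
      |(T h)^[q] (mollify ρ w) x - mollify ρ w x - q * h * G (mollify ρ w) x| ≤ τ * e)
    (hq' : ∀ w, BddLipWith C K w → ∀ x,
      |(T h')^[q'] (mollify ρ w) x - mollify ρ w x - q' * h' * G (mollify ρ w) x| ≤ τ * e)
    (n : ℕ) {f : Euc d → ℝ} (hf : BddLipWith C K f) (x : Euc d) :
    (T h)^[q * n] f x ≤ (T h')^[q' * n] f x + 2 * (K * ρ.rOut)
      + n * (2 * (τ * e) + |q * h - q' * h'| * M) := by
  -- The second discretization is kept mollified throughout the induction. A block of the first,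
  -- applied to `ρ * w`, is replaced by a block of the second through their common expansion, and
  -- Jensen then moves `ρ` outside. The mollification error therefore does not grow with `n`.
  have main : ∀ n : ℕ, ∀ x, (T h)^[q * n] f x ≤ mollify ρ ((T h')^[q' * n] f) x + K * ρ.rOut
      + n * (2 * (τ * e) + |q * h - q' * h'| * M) := by
    intro n
    induction n with
    | zero =>
      intro x
      have := abs_le.1 (abs_mollify_sub_le ρ hK hf x)
      simp
      linarith
    | succ n ih =>
      intro x
      set c := 2 * (τ * e) + |q * h - q' * h'| * M with hc
      have hopq := (hT.op h).iterate q
      have hopq' := (hT.op h').iterate q'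
      have hw := ((hT.op h').iterate (q' * n)).bddLipWith hf
      set w := (T h')^[q' * n] f with hwdef
      have e1 : (T h)^[q * (n + 1)] f = (T h)^[q] ((T h)^[q * n] f) := by
        rw [← Function.iterate_add_apply]; congr 1; ring
      have e2 : (T h')^[q' * (n + 1)] f = (T h')^[q'] w := by
        rw [hwdef, ← Function.iterate_add_apply]; congr 1; ring
      rw [e1, e2]
      have h1 := hopq.le_add_const (((hT.op h).iterate (q * n)).bddLipWith hf).bddLip
        (hw.mollify ρ).bddLip (c := K * ρ.rOut + n * c) (fun y => by linarith [ih y]) x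
      have h2 := abs_le.1 (hq w hw x)
      have h3 := abs_le.1 (hq' w hw x)
      have h4 := hopq'.apply_mollify_le ρ hw.bddLip x
      have h5 : (q * h - q' * h') * G (mollify ρ w) x ≤ |q * h - q' * h'| * M := by
        refine (le_abs_self _).trans ?_
        rw [abs_mul]
        exact mul_le_mul_of_nonneg_left (hM w hw x) (abs_nonneg _)
      push_cast
      linarith
  have h1 := main n x
  have h2 := abs_le.1 (abs_mollify_sub_le ρ hK
    (((hT.op h').iterate (q' * n)).bddLipWith hf) x)
  linarith

/-- The discretizations form a Cauchy net, uniformly on bounded Lipschitz functions with given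
constants. -/
theorem exists_abs_iterate_sub_iterate_le (hT : IsChernoffFamily α T G) {C K e : ℝ} (hC : 0 ≤ C)
    (hK : 0 ≤ K) (he : 0 < e) :
    ∃ δ > (0 : ℝ), ∀ h h' : ℝ, 0 < h → h < δ → 0 < h' → h' < δ → ∀ k k' : ℕ,
      (k : ℝ) * h ≤ 1 → (k' : ℝ) * h' ≤ 1 → |(k : ℝ) * h - k' * h'| < δ →
      ∀ f, BddLipWith C K f → ∀ x, |(T h)^[k] f x - (T h')^[k'] f x| ≤ e := by
  have hε : 0 < e / (16 * (K + 1)) := by positivity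
  let ρ : ContDiffBump (0 : Euc d) :=
    ⟨e / (16 * (K + 1)) / 2, e / (16 * (K + 1)), by positivity, by linarith⟩
  have hKρ : K * ρ.rOut ≤ e / 16 := by
    change K * (e / (16 * (K + 1))) ≤ _
    rw [mul_div_assoc', div_le_div_iff₀ (by positivity) (by norm_num)]
    nlinarith
  have hcons := hT.uniformlyConsistent_mollify ρ K hC
  have hcl : ∀ w ∈ mollify ρ '' {w | BddLipWith C K w}, BddLipWith C K w := by
    rintro _ ⟨w, hw, rfl⟩
    exact BddLipWith.mollify ρ hw
  obtain ⟨M, hM, hGM⟩ := hcons.exists_bound hT.op hC hcl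
  obtain ⟨τ₀, hτ₀, hexp⟩ := hT.exists_time_abs_iterate_sub_sub_le hcons hC hK hcl
    (e := e / 32) (by positivity)
  obtain ⟨τ₁, hτ₁, htight⟩ := hT.exists_time_abs_iterate_sub_le hC hK (e := e / 8) (by positivity)
  -- The block length: the expansion holds up to `τ₀`, and an incomplete block must be negligible,
  -- hence shorter than the tightness time `τ₁`.
  set τ : ℝ := min τ₀ (τ₁ / 4) with hτdef
  have hτ : 0 < τ := by positivity
  obtain ⟨δ₀, hδ₀, hδ⟩ := mem_nhdsGT_iff_exists_Ioo_subset.1 (hexp.and htight)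
  -- In order: both short time estimates hold; a block lasts at least `τ / 2`, so there are at most
  -- `2 / τ` of them; the accumulated mismatch in total time stays within the tightness range; the
  -- accumulated mismatch times `M` is at most `e / 8`.
  set δ : ℝ := min (min δ₀ (τ / 2)) (min (τ₁ / (2 * (1 + 2 / τ))) (e * τ / (16 * (M + 1)))) with hδdef
  have hδ₀ : 0 < δ₀ := hδ₀
  have hδ0 : 0 < δ := by positivity
  have hδ1 : δ ≤ δ₀ := (min_le_left _ _).trans (min_le_left _ _)
  have hδ2 : δ ≤ τ / 2 := (min_le_left _ _).trans (min_le_right _ _)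
  have hδ3 : δ * (1 + 2 / τ) ≤ τ₁ / 2 := by
    have : δ ≤ τ₁ / (2 * (1 + 2 / τ)) := (min_le_right _ _).trans (min_le_left _ _)
    rw [le_div_iff₀ (by positivity)] at this
    linarith
  have hδ4 : 2 * (δ * M) / τ ≤ e / 8 := by
    have : δ ≤ e * τ / (16 * (M + 1)) := (min_le_right _ _).trans (min_le_right _ _)
    rw [le_div_iff₀ (by positivity)] at this
    rw [div_le_div_iff₀ hτ (by norm_num)]
    nlinarith
  refine ⟨δ, hδ0, ?_⟩
  have hclose : ∀ h, 0 < h → h < δ → ∀ a b : ℕ, |(a : ℝ) * h - b * h| ≤ τ₁ →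
      ∀ f, BddLipWith C K f → ∀ x, |(T h)^[a] f x - (T h)^[b] f x| ≤ e / 8 := by
    intro h h0 hhδ
    have key : ∀ a b : ℕ, a ≤ b → |(a : ℝ) * h - b * h| ≤ τ₁ →
        ∀ f, BddLipWith C K f → ∀ x, |(T h)^[b] f x - (T h)^[a] f x| ≤ e / 8 := by
      intro a b hab hd f hf x
      obtain ⟨c, rfl⟩ := Nat.exists_eq_add_of_le hab
      rw [Function.iterate_add_apply]
      refine ((hT.op h).iterate a).abs_sub_le (((hT.op h).iterate c).bddLip hf.bddLip) hf.bddLip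
        (fun y => ?_) x
      refine (hδ ⟨h0, hhδ.trans_le hδ1⟩).2 c ?_ f hf y
      have := neg_abs_le ((a : ℝ) * h - ((a + c : ℕ) : ℝ) * h)
      push_cast at this hd
      linarith
    intro a b hd f hf x
    rcases le_total a b with hab | hab
    · rw [abs_sub_comm]; exact key a b hab hd f hf x
    · exact key b a hab (by rwa [abs_sub_comm]) f hf x
  have main : ∀ h h' : ℝ, 0 < h → h < δ → 0 < h' → h' < δ → ∀ k k' : ℕ,
      (k : ℝ) * h ≤ 1 → |(k : ℝ) * h - k' * h'| < δ →
      ∀ f, BddLipWith C K f → ∀ x, (T h)^[k] f x ≤ (T h')^[k'] f x + e := by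
    intro h h' h0 hhδ h0' hhδ' k k' hk hkk f hf x
    have hfloor : ∀ h : ℝ, 0 < h → h < δ →
        ((⌊τ / h⌋₊ : ℕ) : ℝ) * h ≤ τ ∧ τ - h < ((⌊τ / h⌋₊ : ℕ) : ℝ) * h := by
      intro h h0 _
      have h1 := Nat.floor_le (show 0 ≤ τ / h by positivity)
      have h2 := Nat.lt_floor_add_one (τ / h)
      rw [le_div_iff₀ h0] at h1
      rw [div_lt_iff₀ h0] at h2
      exact ⟨h1, by linarith⟩
    obtain ⟨hq1, hq2⟩ := hfloor h h0 hhδ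
    obtain ⟨hq1', hq2'⟩ := hfloor h' h0' hhδ'
    set q := ⌊τ / h⌋₊
    set q' := ⌊τ / h'⌋₊
    have hqq : |(q : ℝ) * h - q' * h'| ≤ δ := abs_le.2 ⟨by linarith, by linarith⟩
    -- The number of complete blocks. The same `n` serves for `h'`, whose total time differs little,
    -- and both remainders are discarded by `hclose`.
    set n := k / q with hn
    have hnk : (n : ℝ) * (q * h) ≤ k * h := by
      have : ((n * q : ℕ) : ℝ) ≤ k := by exact_mod_cast Nat.div_mul_le_self k q
      push_cast at this
      nlinarith
    have hqpos : 0 < q := by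
      rcases Nat.eq_zero_or_pos q with h1 | h1
      · rw [h1] at hq2; simp at hq2; linarith
      · exact h1
    have hkn : (k : ℝ) * h ≤ n * (q * h) + τ := by
      have h1 : k ≤ n * q + q := by
        have := Nat.div_add_mod k q
        have h2 := Nat.mod_lt k hqpos
        rw [mul_comm, ← hn] at this
        omega
      have h2 : (k : ℝ) ≤ n * q + q := by exact_mod_cast h1
      nlinarith
    have hnτ : (n : ℝ) * τ ≤ 2 := by
      have h1 : (n : ℝ) * (τ / 2) ≤ n * (q * h) :=
        mul_le_mul_of_nonneg_left (by linarith) (Nat.cast_nonneg n)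
      linarith
    have hnδ : (n : ℝ) * δ ≤ δ * (2 / τ) := by
      have : (n : ℝ) ≤ 2 / τ := by rwa [le_div_iff₀ hτ]
      nlinarith
    have hnqq : (n : ℝ) * |(q : ℝ) * h - q' * h'| ≤ n * δ :=
      mul_le_mul_of_nonneg_left hqq (Nat.cast_nonneg n)
    have hτ4 : τ ≤ τ₁ / 4 := min_le_right _ _
    have c1 := hclose h h0 hhδ k (q * n) (by
      have h1 : (q : ℝ) * n * h = n * (q * h) := by ring
      push_cast
      rw [h1]
      exact abs_le.2 ⟨by linarith, by linarith⟩) f hf x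
    have c2 := hclose h' h0' hhδ' k' (q' * n) (by
      have h1 := abs_le.1 (show |(n : ℝ) * (q * h - q' * h')| ≤ n * δ by
        rw [abs_mul, abs_of_nonneg (Nat.cast_nonneg n)]; exact hnqq)
      have h2 := abs_lt.1 hkk
      have h3 : (q' : ℝ) * n * h' = n * (q * h) - n * (q * h - q' * h') := by ring
      push_cast
      rw [h3]
      exact abs_le.2 ⟨by linarith, by linarith⟩) f hf x
    have hexp' : ∀ h, 0 < h → h < δ → ∀ q : ℕ, (q : ℝ) * h ≤ τ → ∀ w, BddLipWith C K w → ∀ x,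
        |(T h)^[q] (mollify ρ w) x - mollify ρ w x - q * h * G (mollify ρ w) x| ≤ τ * (e / 32) := by
      intro h h0 hhδ q hq w hw x
      refine ((hδ ⟨h0, hhδ.trans_le hδ1⟩).1 q (hq.trans (min_le_left _ _)) _
        (mem_image_of_mem _ hw) x).trans ?_
      exact mul_le_mul_of_nonneg_right hq (by positivity)
    have c3 := hT.iterate_le_iterate_add ρ hK (M := M)
      (fun w hw x => hGM _ (mem_image_of_mem _ hw) x) (hexp' h h0 hhδ q hq1)
      (hexp' h' h0' hhδ' q' hq1') n hf x
    have c4 : (n : ℝ) * (2 * (τ * (e / 32)) + |q * h - q' * h'| * M) ≤ e / 8 + e / 8 := by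
      have h1 : (n : ℝ) * (2 * (τ * (e / 32))) = (n * τ) * (e / 16) := by ring
      have h2 : (n * τ) * (e / 16) ≤ 2 * (e / 16) :=
        mul_le_mul_of_nonneg_right hnτ (by positivity)
      have h3 : (n : ℝ) * |(q : ℝ) * h - q' * h'| * M ≤ δ * (2 / τ) * M :=
        mul_le_mul_of_nonneg_right (hnqq.trans hnδ) hM
      have h4 : δ * (2 / τ) * M = 2 * (δ * M) / τ := by ring
      rw [mul_add, h1, ← mul_assoc]
      linarith
    have d1 := abs_le.1 c1
    have d2 := abs_le.1 c2
    linarith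
  intro h h' h0 hhδ h0' hhδ' k k' hk hk' hkk f hf x
  have h1 := main h h' h0 hhδ h0' hhδ' k k' hk hkk f hf x
  have h2 := main h' h h0' hhδ' h0 hhδ k' k hk' (by rwa [abs_sub_comm]) f hf x
  exact abs_le.2 ⟨by linarith, by linarith⟩

end IsChernoffFamily

/-! ### Random walks on a sublinear expectation space -/

/-- Passing between steps, positions and increments is linear in finitely many vectors, so no
explicit Lipschitz constants are needed. -/
theorem exists_lipschitzWith_of_isLinearMap {V W : Type*} [NormedAddCommGroup V] [NormedSpace ℝ V]
    [FiniteDimensional ℝ V] [NormedAddCommGroup W] [NormedSpace ℝ W] {P : V → W}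
    (hP : IsLinearMap ℝ P) : ∃ L : ℝ≥0, LipschitzWith L P :=
  ⟨_, (hP.mk' P).toContinuousLinearMap.lipschitz⟩

namespace IsSublinearExpectation

variable {Ω : Type*} {H : Set (Ω → ℝ)} {E : (Ω → ℝ) → ℝ} {X Y : Ω → ℝ} {c : ℝ}

theorem const_mem (hE : IsSublinearExpectation H E) (c : ℝ) : (fun _ : Ω => c) ∈ H :=
  hE.comp_mem 0 (fun i _ => i.elim0) (fun i => i.elim0) (fun _ => c) (bddLip_const c)

theorem le_add_const (hE : IsSublinearExpectation H E) (hX : X ∈ H) (hY : Y ∈ H)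
    (h : ∀ ω, X ω ≤ Y ω + c) : E X ≤ E Y + c := by
  have h1 := hE.mono (Y + fun _ => c) (hE.add_mem Y hY _ (hE.const_mem c)) X hX h
  have h2 := hE.subadd Y hY _ (hE.const_mem c)
  rw [hE.const] at h2
  linarith

theorem abs_sub_le (hE : IsSublinearExpectation H E) (hX : X ∈ H) (hY : Y ∈ H)
    (h : ∀ ω, |X ω - Y ω| ≤ c) : |E X - E Y| ≤ c := by
  have h1 := hE.le_add_const hX hY (c := c) fun ω => by linarith [le_abs_self (X ω - Y ω), h ω]
  have h2 := hE.le_add_const hY hX (c := c) fun ω => by linarith [neg_abs_le (X ω - Y ω), h ω]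
  exact abs_le.2 ⟨by linarith, by linarith⟩

theorem abs_le_of_forall (hE : IsSublinearExpectation H E) (hX : X ∈ H) (h : ∀ ω, |X ω| ≤ c) :
    |E X| ≤ c := by
  have := hE.abs_sub_le hX (hE.const_mem 0) (c := c) (by simpa using h)
  rwa [hE.const, sub_zero] at this

theorem add_const (hE : IsSublinearExpectation H E) (hX : X ∈ H) (c : ℝ) :
    E (fun ω => X ω + c) = E X + c := by
  have hXc : (fun ω => X ω + c) ∈ H := hE.add_mem X hX _ (hE.const_mem c)
  have h1 := hE.le_add_const hXc hX (c := c) fun ω => le_rfl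
  have h2 := hE.le_add_const hX hXc (c := -c) fun ω => by linarith
  linarith

end IsSublinearExpectation

theorem IsRandomVariable.comp {Ω V W : Type*} [PseudoMetricSpace V] [PseudoMetricSpace W]
    {H : Set (Ω → ℝ)} {X : Ω → V} (hX : IsRandomVariable H X) {Φ : V → W} {L : ℝ≥0}
    (hΦ : LipschitzWith L Φ) : IsRandomVariable H (fun ω => Φ (X ω)) :=
  fun _ hφ => hX _ (hφ.comp hΦ)

/-- The one step operator `f ↦ E[f(x + s^{1/α} X)]`. -/
noncomputable def stepOp {Ω : Type*} {d : ℕ} (E : (Ω → ℝ) → ℝ) (α : ℝ) (X : Ω → Euc d) (s : ℝ)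
    (f : Euc d → ℝ) (x : Euc d) : ℝ :=
  E (fun ω => f (x + s ^ (1 / α) • X ω))

theorem lipschitzWith_add_smul {d : ℕ} (x : Euc d) (c : ℝ) :
    LipschitzWith ‖c‖₊ (fun y : Euc d => x + c • y) :=
  LipschitzWith.of_dist_le_mul fun y z => by
    rw [dist_add_left, dist_smul₀]
    rfl

section RandomWalk

variable {Ω : Type*} {d : ℕ} {H : Set (Ω → ℝ)} {E : (Ω → ℝ) → ℝ}

theorem isSublinearOp_stepOp (hE : IsSublinearExpectation H E) (α : ℝ) {X : Ω → Euc d}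
    (hX : IsRandomVariable H X) (s : ℝ) : IsSublinearOp (stepOp E α X s) := by
  have hmem : ∀ {f : Euc d → ℝ}, BddLip f → ∀ x, (fun ω => f (x + s ^ (1 / α) • X ω)) ∈ H :=
    fun hf x => hX.comp (lipschitzWith_add_smul x _) _ hf
  refine ⟨fun {C K f} hf => ⟨fun x => ?_, fun x y => ?_⟩, fun hf hg h x => ?_,
    fun hf hg x => ?_, fun {c f} hc hf x => ?_, fun c x => hE.const c, fun f a x => ?_⟩
  · exact hE.abs_le_of_forall (hmem hf.bddLip x) fun ω => hf.1 _
  · refine hE.abs_sub_le (hmem hf.bddLip x) (hmem hf.bddLip y) fun ω => ?_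
    simpa using hf.2 (x + s ^ (1 / α) • X ω) (y + s ^ (1 / α) • X ω)
  · exact hE.mono _ (hmem hg x) _ (hmem hf x) fun ω => h _
  · exact hE.subadd _ (hmem hf x) _ (hmem hg x)
  · rcases hc.eq_or_lt with rfl | hc
    · simp [stepOp, hE.const]
    · exact hE.pos_homog c hc _ (hmem hf x)
  · simp only [stepOp, add_right_comm]

/-- The scaling is the identity `(s R^{-α})^{1/α} = R⁻¹ s^{1/α}`; the rest is the consistency
condition with the constant `φ(x)` taken out of the expectation. -/
theorem isChernoffFamily_stepOp (hE : IsSublinearExpectation H E) {α : ℝ} (hα : 0 < α)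
    {Λlo Λhi : ℝ} {X : Ω → Euc d} (hX : IsRandomVariable H X)
    (hcons : ConsistencyCondition E α Λlo Λhi X) :
    IsChernoffFamily α (stepOp E α X) (supGenerator α Λlo Λhi) := by
  refine ⟨hα, isSublinearOp_stepOp hE α hX, fun s R hs hR f => ?_, fun φ hφ e he => ?_⟩
  · have : (s * R ^ (-α)) ^ (1 / α) = R⁻¹ * s ^ (1 / α) := by
      rw [Real.mul_rpow hs.le (Real.rpow_nonneg hR.le _), ← Real.rpow_mul hR.le,
        show -α * (1 / α) = -1 by field_simp, Real.rpow_neg_one, mul_comm]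
    simp only [stepOp, this, zero_add, smul_smul]
  · obtain ⟨l, hl, h⟩ := hcons φ hφ
    filter_upwards [hl.eventually (gt_mem_nhds he), Ioo_mem_nhdsGT one_pos] with s hls hs x
    have h1 := h s ⟨hs.1, hs.2.le⟩ x
    have h2 : E (fun ω => φ (x + s ^ (1 / α) • X ω) - φ x) = stepOp E α X s φ x - φ x := by
      simp only [sub_eq_add_neg]
      exact hE.add_const (hX.comp (lipschitzWith_add_smul x _) _ hφ.bddLip) (-φ x)
    rw [h2, one_div, inv_mul_le_iff₀ hs.1] at h1
    exact h1.trans (mul_le_mul_of_nonneg_left hls.le hs.1.le)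

variable {Z : ℕ → Ω → Euc d}

theorem IsIID.isRandomVariable_init (hE : IsSublinearExpectation H E) (hZ : IsIID H E Z) (i : ℕ) :
    IsRandomVariable H (fun ω (j : Fin i) => Z j ω) := by
  cases i with
  | zero =>
    intro φ _
    have : (fun ω => φ fun j : Fin 0 => Z j ω) = fun _ => φ fun j => j.elim0 := by
      ext ω; congr 1; ext j; exact j.elim0
    rw [this]
    exact hE.const_mem _
  | succ i => exact (hZ.indep i).1.comp LipschitzWith.prod_fst

theorem IsIID.identDist_zero (hZ : IsIID H E Z) (i : ℕ) : IdentDist E (Z i) E (Z 0) := by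
  induction i with
  | zero => exact fun φ _ => rfl
  | succ i ih => exact fun φ hφ => (hZ.identDist i φ hφ).trans (ih φ hφ)

theorem lipschitzWith_prodMk_const_left {V W : Type*} [PseudoMetricSpace V] [PseudoMetricSpace W]
    (x : V) : LipschitzWith 1 (fun y : W => (x, y)) :=
  LipschitzWith.of_dist_le_mul fun y z => by simp [Prod.dist_eq]

theorem IsIID.expect_init_eq (hE : IsSublinearExpectation H E) (hZ : IsIID H E Z) (i : ℕ)
    {f : (Fin i → Euc d) × Euc d → ℝ} (hf : BddLip f) :
    E (fun ω => f (fun j => Z j ω, Z i ω)) =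
      E (fun ω => E (fun ω' => f (fun j => Z j ω, Z 0 ω'))) := by
  cases i with
  | zero =>
    have h : ∀ ω ω', (fun j : Fin 0 => Z j ω) = fun j : Fin 0 => Z j ω' := fun ω ω' => by
      ext j; exact j.elim0
    have h1 : ∀ ω, E (fun ω' => f (fun j => Z j ω, Z 0 ω')) = E (fun ω => f (fun j => Z j ω, Z 0 ω)) :=
      fun ω => congrArg E (funext fun ω' => by rw [h ω ω'])
    simp only [h1]
    rw [hE.const]
  | succ i =>
    rw [(hZ.indep i).2 f hf]
    congr 1
    ext ω
    exact hZ.identDist_zero (i + 1) _ (hf.comp (lipschitzWith_prodMk_const_left _))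

/-- The last step is integrated out first, conditionally on all the others, which replaces `f` by
its image under one step operator in the last variable. The statement ranges over all `f` because
this image is the function used in the induction hypothesis. -/
theorem IsIID.expect_increment_eq (hE : IsSublinearExpectation H E) (hZ : IsIID H E Z) (α h : ℝ)
    (a k : ℕ) : ∀ {f : (Fin a → Euc d) × Euc d → ℝ}, BddLip f →
      E (fun ω => f (fun j => Z j ω,
        h ^ (1 / α) • (partialSum Z (a + k) ω - partialSum Z a ω))) =
      E (fun ω => (stepOp E α (Z 0) h)^[k] (fun y => f (fun j => Z j ω, y)) 0) := by
  induction k with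
  | zero => intro f _; simp
  | succ k ih =>
    intro f hf
    set c := h ^ (1 / α) with hc
    have hT := isSublinearOp_stepOp hE α (hZ.randomVariable 0) h
    have hlin : ∀ ω, partialSum Z (a + k) ω - partialSum Z a ω = ∑ j : Fin k, Z (a + j) ω := by
      intro ω
      rw [partialSum, partialSum, Finset.sum_range_add_sub_sum_range]
      exact (Fin.sum_univ_eq_sum_range (fun j => Z (a + j) ω) k).symm
    let P : (Fin (a + k) → Euc d) × Euc d → (Fin a → Euc d) × Euc d := fun p =>
      (fun i => p.1 (Fin.castAdd k i), c • (∑ j : Fin k, p.1 (Fin.natAdd a j)) + c • p.2)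
    have hP : IsLinearMap ℝ P := by
      refine ⟨fun p p' => ?_, fun r p => ?_⟩
      · refine Prod.ext rfl ?_
        simp only [P, Prod.fst_add, Prod.snd_add, Pi.add_apply, Finset.sum_add_distrib, smul_add]
        abel
      · refine Prod.ext rfl ?_
        simp only [P, Prod.smul_fst, Prod.smul_snd, Pi.smul_apply, ← Finset.smul_sum, smul_add,
          smul_comm c r]
    obtain ⟨L, hL⟩ := exists_lipschitzWith_of_isLinearMap hP
    have e1 : ∀ ω, f (fun j => Z j ω, c • (partialSum Z (a + (k + 1)) ω - partialSum Z a ω))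
        = f (P (fun j => Z j ω, Z (a + k) ω)) := by
      intro ω
      have : partialSum Z (a + (k + 1)) ω - partialSum Z a ω
          = ∑ j : Fin k, Z (a + j) ω + Z (a + k) ω := by
        rw [← hlin, ← add_assoc]
        simp only [partialSum, Finset.sum_range_succ]
        abel
      rw [this, smul_add]
      rfl
    simp only [e1]
    rw [hZ.expect_init_eq hE (a + k) (hf.comp hL)]
    have hfz : ∀ z, BddLip (fun y => f (z, y)) := fun z =>
      hf.comp (lipschitzWith_prodMk_const_left z)
    -- Joint regularity: contractivity of the step operator handles the past, and its preservation
    -- of Lipschitz constants handles the current position, whence the constant `2 * K`.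
    have hg : BddLip (fun p : (Fin a → Euc d) × Euc d =>
        stepOp E α (Z 0) h (fun y => f (p.1, y)) p.2) := by
      obtain ⟨C, K, hC, hK, hfL⟩ := hf.exists_with
      have hfzL : ∀ z, BddLipWith C K (fun y => f (z, y)) := fun z =>
        ⟨fun y => hfL.1 _, fun y y' => by simpa [Prod.dist_eq] using hfL.2 (z, y) (z, y')⟩
      have hgL : BddLipWith C (2 * K) (fun p : (Fin a → Euc d) × Euc d =>
          stepOp E α (Z 0) h (fun y => f (p.1, y)) p.2) := by
        refine ⟨fun p => (hT.bddLipWith (hfzL p.1)).1 _, fun p p' => ?_⟩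
        have b1 := (hT.bddLipWith (hfzL p.1)).2 p.2 p'.2
        have b2 := hT.abs_sub_le (hfz p.1) (hfz p'.1) (c := K * dist p.1 p'.1)
          (fun y => by simpa [Prod.dist_eq] using hfL.2 (p.1, y) (p'.1, y)) p'.2
        have b3 : dist p.1 p'.1 ≤ dist p p' := le_max_left _ _
        have b4 : dist p.2 p'.2 ≤ dist p p' := le_max_right _ _
        have b5 := abs_sub_le (stepOp E α (Z 0) h (fun y => f (p.1, y)) p.2)
          (stepOp E α (Z 0) h (fun y => f (p.1, y)) p'.2)
          (stepOp E α (Z 0) h (fun y => f (p'.1, y)) p'.2)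
        nlinarith
      exact hgL.bddLip
    have e2 := ih hg
    simp only at e2
    refine Eq.trans ?_ (e2.trans ?_)
    · congr 1
      ext ω
      simp only [hlin]
      rfl
    · rfl

/-- The law of an increment of the random walk, jointly with the past. -/
theorem IsIID.expect_pair_eq (hE : IsSublinearExpectation H E) (hZ : IsIID H E Z) (α h : ℝ)
    {m : ℕ} (N : Fin m → ℕ) {a b : ℕ} (hN : ∀ i, N i ≤ a) (hab : a ≤ b)
    {f : (Fin m → Euc d) × Euc d → ℝ} (hf : BddLip f) :
    E (fun ω => f (fun i => h ^ (1 / α) • partialSum Z (N i) ω,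
        h ^ (1 / α) • (partialSum Z b ω - partialSum Z a ω))) =
      E (fun ω => (stepOp E α (Z 0) h)^[b - a]
        (fun y => f (fun i => h ^ (1 / α) • partialSum Z (N i) ω, y)) 0) := by
  obtain ⟨k, rfl⟩ := Nat.exists_eq_add_of_le hab
  let P : (Fin a → Euc d) × Euc d → (Fin m → Euc d) × Euc d := fun p =>
    (fun i => h ^ (1 / α) • ∑ j : Fin (N i), p.1 (Fin.castLE (hN i) j), p.2)
  have hP : IsLinearMap ℝ P := by
    refine ⟨fun p p' => ?_, fun r p => ?_⟩
    · refine Prod.ext ?_ rfl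
      ext1 i
      simp only [P, Prod.fst_add, Pi.add_apply, Finset.sum_add_distrib, smul_add]
    · refine Prod.ext ?_ rfl
      ext1 i
      simp only [P, Prod.smul_fst, Pi.smul_apply, ← Finset.smul_sum]
      exact smul_comm _ _ _
  obtain ⟨L, hL⟩ := exists_lipschitzWith_of_isLinearMap hP
  have hPZ : ∀ ω y, P (fun j => Z j ω, y)
      = (fun i => h ^ (1 / α) • partialSum Z (N i) ω, y) := by
    intro ω y
    refine Prod.ext ?_ rfl
    ext1 i
    simp only [P, partialSum, Fin.val_castLE]
    rw [Fin.sum_univ_eq_sum_range (fun j => Z j ω)]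
  have key := hZ.expect_increment_eq hE α h a k (hf.comp hL)
  simp only [hPZ] at key
  rw [Nat.add_sub_cancel_left]
  exact key

theorem IsIID.isRandomVariable_partialSum (hE : IsSublinearExpectation H E) (hZ : IsIID H E Z)
    (c : ℝ) {ι : Type*} [Fintype ι] (N : ι → ℕ) :
    IsRandomVariable H (fun ω i => c • partialSum Z (N i) ω) := by
  obtain ⟨a, ha⟩ : ∃ a, ∀ i, N i ≤ a := ⟨∑ i, N i, fun i => Finset.single_le_sum
    (fun _ _ => Nat.zero_le _) (Finset.mem_univ i)⟩
  let P : (Fin a → Euc d) → ι → Euc d := fun z i => c • ∑ j : Fin (N i), z (Fin.castLE (ha i) j)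
  have hP : IsLinearMap ℝ P := by
    refine ⟨fun p p' => ?_, fun r p => ?_⟩
    · ext1 i
      simp only [P, Pi.add_apply, Finset.sum_add_distrib, smul_add]
    · ext1 i
      simp only [P, Pi.smul_apply, ← Finset.smul_sum]
      exact smul_comm _ _ _
  obtain ⟨L, hL⟩ := exists_lipschitzWith_of_isLinearMap hP
  have hPZ : ∀ ω, P (fun j => Z j ω) = fun i => c • partialSum Z (N i) ω := by
    intro ω
    ext1 i
    simp only [P, partialSum, Fin.val_castLE]
    rw [Fin.sum_univ_eq_sum_range (fun j => Z j ω)]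
  have := (hZ.isRandomVariable_init hE a).comp hL
  simpa only [hPZ] using this

theorem IsIID.expect_sub_eq (hE : IsSublinearExpectation H E) (hZ : IsIID H E Z) (α h : ℝ)
    {a b : ℕ} (hab : a ≤ b) {f : Euc d → ℝ} (hf : BddLip f) :
    E (fun ω => f (h ^ (1 / α) • (partialSum Z b ω - partialSum Z a ω))) =
      (stepOp E α (Z 0) h)^[b - a] f 0 := by
  have := hZ.expect_pair_eq hE α h (m := 0) (fun i => i.elim0) (fun i => i.elim0) hab
    (hf.comp (φ := Prod.snd) LipschitzWith.prod_snd)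
  simp only at this
  rw [this, hE.const]

theorem IsIID.expect_partialSum_eq (hE : IsSublinearExpectation H E) (hZ : IsIID H E Z) (α h : ℝ)
    (b : ℕ) {f : Euc d → ℝ} (hf : BddLip f) :
    E (fun ω => f (h ^ (1 / α) • partialSum Z b ω)) = (stepOp E α (Z 0) h)^[b] f 0 := by
  have := hZ.expect_sub_eq hE α h (Nat.zero_le b) hf
  simpa [partialSum] using this

end RandomWalk

/-! ### Cylinder functions -/

theorem sum_castLE_sub {V : Type*} [AddCommGroup V] {m : ℕ} (b : Fin (m + 1) → V) (k : ℕ)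
    (hk : k ≤ m) :
    ∑ j : Fin k, (b (Fin.castLE hk j).succ - b (Fin.castLE hk j).castSucc)
      = b ⟨k, Nat.lt_succ_of_le hk⟩ - b 0 := by
  induction k with
  | zero => simp
  | succ k ih =>
    rw [Fin.sum_univ_castSucc]
    have := ih (Nat.le_of_succ_le hk)
    have h1 : ∀ j : Fin k, Fin.castLE hk j.castSucc = Fin.castLE (Nat.le_of_succ_le hk) j :=
      fun j => rfl
    simp only [h1, this]
    have h2 : (Fin.castLE hk (Fin.last k)).castSucc = ⟨k, Nat.lt_succ_of_le (Nat.le_of_succ_le hk)⟩ :=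
      rfl
    have h3 : (Fin.castLE hk (Fin.last k)).succ = ⟨k + 1, Nat.lt_succ_of_le hk⟩ := rfl
    rw [h2, h3]
    abel

theorem canonical_zero {d : ℕ} (w : PathSpace d) : canonical d 0 w = 0 := w.2.1

/-- Arbitrary times, unordered and possibly repeated, are sorted; positions are then partial sums of
increments, hence a linear function of them. With `exists_of_mem_cylinderLip` this allows working
with positions at any finite family of times, and makes closure under sums a matter of joining
families. -/
theorem mem_cylinderLip {d : ℕ} {ι : Type*} [Fintype ι] (τ : ι → unitInterval)
    {φ : (ι → Euc d) → ℝ} (hφ : BddLip φ) :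
    (fun w => φ fun i => canonical d (τ i) w) ∈ cylinderLip d := by
  classical
  let s : Finset unitInterval := Finset.univ.image τ
  let t := s.orderEmbOfFin rfl
  have hσ : ∀ i, ∃ k, t k = τ i := fun i => by
    have : τ i ∈ Set.range t := by
      rw [Finset.range_orderEmbOfFin]
      simp [s]
    exact this
  choose σ hσ using hσ
  let P : (Fin s.card → Euc d) → ι → Euc d := fun x i =>
    ∑ j : Fin (σ i + 1), x (Fin.castLE (σ i).2 j)
  have hP : IsLinearMap ℝ P := by
    refine ⟨fun p p' => ?_, fun r p => ?_⟩
    · ext1 i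
      simp only [P, Pi.add_apply, Finset.sum_add_distrib]
    · ext1 i
      simp only [P, Pi.smul_apply, ← Finset.smul_sum]
  obtain ⟨L, hL⟩ := exists_lipschitzWith_of_isLinearMap hP
  refine ⟨s.card, t, fun x => φ (P x), t.strictMono, hφ.comp hL, ?_⟩
  ext w
  congr 1
  ext1 i
  have := sum_castLE_sub
    (fun j => canonical d ((Fin.cons 0 t : Fin (s.card + 1) → unitInterval) j) w) (σ i + 1) (σ i).2
  simp only [Fin.cons_succ, Fin.cons_zero, canonical_zero, sub_zero] at this
  simp only [P, this]
  have h2 : (⟨σ i + 1, Nat.lt_succ_of_le (σ i).2⟩ : Fin (s.card + 1)) = (σ i).succ := rfl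
  rw [h2, Fin.cons_succ, hσ]

theorem exists_of_mem_cylinderLip {d : ℕ} {X : PathSpace d → ℝ} (hX : X ∈ cylinderLip d) :
    ∃ (n : ℕ) (τ : Fin n → unitInterval) (φ : (Fin n → Euc d) → ℝ), BddLip φ ∧
      X = fun w => φ fun i => canonical d (τ i) w := by
  obtain ⟨n, t, φ, -, hφ, rfl⟩ := hX
  have hP : IsLinearMap ℝ (fun (y : Fin (n + 1) → Euc d) (i : Fin n) => y i.succ - y i.castSucc) := by
    refine ⟨fun p p' => ?_, fun r p => ?_⟩
    · ext1 i
      simp only [Pi.add_apply]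
      abel
    · ext1 i
      simp only [Pi.smul_apply, smul_sub]
  obtain ⟨L, hL⟩ := exists_lipschitzWith_of_isLinearMap hP
  refine ⟨n + 1, Fin.cons 0 t, fun y => φ fun i => y i.succ - y i.castSucc, hφ.comp hL, ?_⟩
  ext w
  simp only [Fin.cons_succ]

theorem lipschitzWith_comp_left {ι κ V : Type*} [Fintype ι] [Fintype κ] [PseudoMetricSpace V]
    (e : κ → ι) : LipschitzWith 1 (fun (y : ι → V) (j : κ) => y (e j)) :=
  LipschitzWith.of_dist_le_mul fun x y => by
    rw [NNReal.coe_one, one_mul, dist_pi_le_iff dist_nonneg]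
    exact fun j => dist_le_pi_dist x y (e j)

theorem cylinderLip_add {d : ℕ} {X Y : PathSpace d → ℝ} (hX : X ∈ cylinderLip d)
    (hY : Y ∈ cylinderLip d) : X + Y ∈ cylinderLip d := by
  obtain ⟨n, τ, φ, hφ, rfl⟩ := exists_of_mem_cylinderLip hX
  obtain ⟨m, σ, ψ, hψ, rfl⟩ := exists_of_mem_cylinderLip hY
  exact mem_cylinderLip (ι := Fin n ⊕ Fin m) (Sum.elim τ σ)
    ((hφ.comp (lipschitzWith_comp_left Sum.inl)).add (hψ.comp (lipschitzWith_comp_left Sum.inr)))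

theorem cylinderLip_smul {d : ℕ} (c : ℝ) {X : PathSpace d → ℝ} (hX : X ∈ cylinderLip d) :
    c • X ∈ cylinderLip d := by
  obtain ⟨n, τ, φ, hφ, rfl⟩ := exists_of_mem_cylinderLip hX
  exact mem_cylinderLip τ (hφ.const_mul c)

theorem cylinderLip_comp {d n : ℕ} {X : Fin n → PathSpace d → ℝ} (hX : ∀ i, X i ∈ cylinderLip d)
    {φ : (Fin n → ℝ) → ℝ} (hφ : BddLip φ) : (fun w => φ fun i => X i w) ∈ cylinderLip d := by
  choose m τ ψ hψ hXψ using fun i => exists_of_mem_cylinderLip (hX i)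
  choose C K _ hK hψ using fun i => (hψ i).exists_with
  have hL : LipschitzWith (∑ i, K i).toNNReal
      (fun (y : (Σ i, Fin (m i)) → Euc d) (i : Fin n) => ψ i fun j => y ⟨i, j⟩) := by
    refine LipschitzWith.of_dist_le_mul fun x y => ?_
    rw [dist_pi_le_iff (by positivity), Real.coe_toNNReal _ (Finset.sum_nonneg fun i _ => hK i)]
    intro i
    refine ((hψ i).2 _ _).trans (mul_le_mul (Finset.single_le_sum (fun i _ => hK i)
      (Finset.mem_univ i)) ?_ dist_nonneg (Finset.sum_nonneg fun i _ => hK i))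
    rw [dist_pi_le_iff dist_nonneg]
    exact fun j => dist_le_pi_dist x y ⟨i, j⟩
  have := mem_cylinderLip (d := d) (fun p : Σ i, Fin (m i) => τ p.1 p.2) (hφ.comp hL)
  convert this using 3 with w
  ext1 i
  rw [hXψ i]

theorem cylinderLip_zero (d : ℕ) : (0 : PathSpace d → ℝ) ∈ cylinderLip d :=
  mem_cylinderLip (ι := Fin 0) (fun i => i.elim0) (φ := fun _ => 0) (bddLip_const 0)

theorem exists_abs_le_of_mem_cylinderLip {d : ℕ} {X : PathSpace d → ℝ} (hX : X ∈ cylinderLip d) :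
    ∃ C, ∀ w, |X w| ≤ C := by
  obtain ⟨n, t, φ, -, hφ, rfl⟩ := hX
  exact ⟨hφ.1.choose, fun w => hφ.1.choose_spec _⟩

/-! ### Random walk paths -/

theorem isCadlag_comp_floor {V : Type*} [TopologicalSpace V] (S : ℕ → V) (n : ℕ) :
    IsCadlag (fun t : unitInterval => S ⌊(n : ℝ) * t⌋₊) := by
  intro t
  have hcont : Continuous fun u : unitInterval => (n : ℝ) * u := by fun_prop
  have hnn : ∀ u : unitInterval, 0 ≤ (n : ℝ) * u := fun u => mul_nonneg (Nat.cast_nonneg n) u.2.1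
  constructor
  · refine tendsto_const_nhds.congr' ?_
    have h1 : ∀ᶠ u : unitInterval in 𝓝 t, (n : ℝ) * (u : ℝ) < ⌊(n : ℝ) * t⌋₊ + 1 :=
      hcont.continuousAt.eventually (gt_mem_nhds (Nat.lt_floor_add_one _))
    filter_upwards [mem_nhdsWithin_of_mem_nhds h1, self_mem_nhdsWithin] with u hu hut
    have hut : (t : ℝ) ≤ u := hut
    congr 1
    symm
    rw [Nat.floor_eq_iff (hnn u)]
    refine ⟨(Nat.floor_le (hnn t)).trans ?_, hu⟩
    exact mul_le_mul_of_nonneg_left hut (Nat.cast_nonneg n)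
  · rcases Nat.eq_zero_or_pos n with rfl | hn
    · exact ⟨S 0, by simpa using tendsto_const_nhds⟩
    have hn' : (0 : ℝ) < n := Nat.cast_pos.2 hn
    -- Just to the left of `t` the floor of `n u` is the ceiling of `n t` minus one; a zero ceiling
    -- forces `t = 0`, where there is nothing to the left.
    rcases hc : ⌈(n : ℝ) * t⌉₊ with _ | m
    · refine ⟨S 0, tendsto_const_nhds.congr' ?_⟩
      filter_upwards [self_mem_nhdsWithin] with u hut
      have hut : (u : ℝ) < t := hut
      have h1 := Nat.ceil_eq_zero.1 hc
      have h2 := mul_lt_mul_of_pos_left hut hn'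
      linarith [hnn u]
    · refine ⟨S m, tendsto_const_nhds.congr' ?_⟩
      have h0 : (m : ℝ) < n * t := Nat.lt_ceil.1 (by rw [hc]; exact Nat.lt_succ_self m)
      have h1 : ∀ᶠ u : unitInterval in 𝓝 t, (m : ℝ) < (n : ℝ) * (u : ℝ) :=
        hcont.continuousAt.eventually (lt_mem_nhds h0)
      filter_upwards [mem_nhdsWithin_of_mem_nhds h1, self_mem_nhdsWithin] with u hu hut
      have hut : (u : ℝ) < t := hut
      congr 1
      symm
      rw [Nat.floor_eq_iff (hnn u)]
      refine ⟨hu.le, ?_⟩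
      have h2 : (n : ℝ) * t ≤ m + 1 := by
        have := Nat.le_ceil ((n : ℝ) * t)
        rw [hc] at this
        exact_mod_cast this
      have h3 := mul_lt_mul_of_pos_left hut hn'
      linarith

/-- The rescaled random walk path `t ↦ n^{-1/α} S_{⌊nt⌋}`. -/
noncomputable def walkPath {Ω : Type*} {d : ℕ} (α : ℝ) (Z : ℕ → Ω → Euc d) (n : ℕ) (ω : Ω) :
    PathSpace d :=
  ⟨fun t => (1 / (n : ℝ)) ^ (1 / α) • partialSum Z ⌊(n : ℝ) * t⌋₊ ω, by simp [partialSum],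
    isCadlag_comp_floor (fun k => (1 / (n : ℝ)) ^ (1 / α) • partialSum Z k ω) n⟩

/-- The limit, along a fixed ultrafilter, of the expectations of the rescaled random walks. -/
noncomputable def walkLimit {Ω : Type*} {d : ℕ} (E : (Ω → ℝ) → ℝ) (α : ℝ) (Z : ℕ → Ω → Euc d)
    (X : PathSpace d → ℝ) : ℝ :=
  limUnder (hyperfilter ℕ : Filter ℕ) fun n => E fun ω => X (walkPath α Z n ω)

section WalkLimit

variable {Ω : Type*} {d : ℕ} {H : Set (Ω → ℝ)} {E : (Ω → ℝ) → ℝ} {Z : ℕ → Ω → Euc d}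

theorem IsIID.comp_walkPath_mem (hE : IsSublinearExpectation H E) (hZ : IsIID H E Z) (α : ℝ)
    {X : PathSpace d → ℝ} (hX : X ∈ cylinderLip d) (n : ℕ) :
    (fun ω => X (walkPath α Z n ω)) ∈ H := by
  obtain ⟨m, τ, φ, hφ, rfl⟩ := exists_of_mem_cylinderLip hX
  exact hZ.isRandomVariable_partialSum hE _ (fun i => ⌊(n : ℝ) * τ i⌋₊) φ hφ

/-- The expectations stay in a compact interval, so the ultrafilter converges and `limUnder` is a
true limit. One ultrafilter serves all cylinder functions simultaneously, which lets the axioms of a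
sublinear expectation pass to the limit. -/
theorem IsIID.tendsto_walkLimit (hE : IsSublinearExpectation H E) (hZ : IsIID H E Z) (α : ℝ)
    {X : PathSpace d → ℝ} (hX : X ∈ cylinderLip d) :
    Tendsto (fun n => E fun ω => X (walkPath α Z n ω)) (hyperfilter ℕ : Filter ℕ)
      (𝓝 (walkLimit E α Z X)) := by
  obtain ⟨C, hC⟩ := exists_abs_le_of_mem_cylinderLip hX
  obtain ⟨x, -, hx⟩ := (isCompact_Icc (a := -C) (b := C)).ultrafilter_le_nhds
    ((hyperfilter ℕ).map fun n => E fun ω => X (walkPath α Z n ω)) (by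
      rw [le_principal_iff]
      exact Filter.mem_map.2 (Filter.univ_mem' fun n => abs_le.1
        (hE.abs_le_of_forall (hZ.comp_walkPath_mem hE α hX n) fun ω => hC _)))
  exact tendsto_nhds_limUnder ⟨x, hx⟩

theorem IsIID.isSublinearExpectation_walkLimit (hE : IsSublinearExpectation H E)
    (hZ : IsIID H E Z) (α : ℝ) :
    IsSublinearExpectation (cylinderLip d) (walkLimit E α Z) where
  zero_mem := cylinderLip_zero d
  add_mem _ hX _ hY := cylinderLip_add hX hY
  smul_mem c _ hX := cylinderLip_smul c hX
  comp_mem _ _ hX _ hφ := cylinderLip_comp hX hφ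
  mono X hX Y hY h := le_of_tendsto_of_tendsto' (hZ.tendsto_walkLimit hE α hY)
    (hZ.tendsto_walkLimit hE α hX) fun n => hE.mono _ (hZ.comp_walkPath_mem hE α hX n) _
      (hZ.comp_walkPath_mem hE α hY n) fun ω => h _
  const c := by
    have h : (fun _ : PathSpace d => c) ∈ cylinderLip d :=
      mem_cylinderLip (ι := Fin 0) (fun i => i.elim0) (φ := fun _ => c) (bddLip_const c)
    refine tendsto_nhds_unique (hZ.tendsto_walkLimit hE α h) ?_
    simp only [hE.const]
    exact tendsto_const_nhds
  subadd X hX Y hY := le_of_tendsto_of_tendsto'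
    (hZ.tendsto_walkLimit hE α (cylinderLip_add hX hY))
    ((hZ.tendsto_walkLimit hE α hX).add (hZ.tendsto_walkLimit hE α hY)) fun n =>
      hE.subadd _ (hZ.comp_walkPath_mem hE α hX n) _ (hZ.comp_walkPath_mem hE α hY n)
  pos_homog c hc X hX := by
    refine tendsto_nhds_unique (hZ.tendsto_walkLimit hE α (cylinderLip_smul c hX)) ?_
    refine ((hZ.tendsto_walkLimit hE α hX).const_mul c).congr fun n => ?_
    exact (hE.pos_homog c hc _ (hZ.comp_walkPath_mem hE α hX n)).symm

end WalkLimit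

/-! ### The limiting process -/

theorem IsChernoffFamily.eventually_abs_iterate_sub_le {d : ℕ} {α : ℝ}
    {T : ℝ → (Euc d → ℝ) → Euc d → ℝ} {G : (Euc d → ℝ) → Euc d → ℝ}
    (hT : IsChernoffFamily α T G) {ι : Type*} {l : Filter ι} {h h' : ι → ℝ} {k k' : ι → ℕ}
    {C K e : ℝ} (hC : 0 ≤ C) (hK : 0 ≤ K) (he : 0 < e)
    (hh : Tendsto h l (𝓝[>] 0)) (hh' : Tendsto h' l (𝓝[>] 0))
    (hk : ∀ᶠ i in l, (k i : ℝ) * h i ≤ 1) (hk' : ∀ᶠ i in l, (k' i : ℝ) * h' i ≤ 1)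
    (hkk : Tendsto (fun i => (k i : ℝ) * h i - k' i * h' i) l (𝓝 0)) :
    ∀ᶠ i in l, ∀ f, BddLipWith C K f → ∀ x,
      |(T (h i))^[k i] f x - (T (h' i))^[k' i] f x| ≤ e := by
  obtain ⟨δ, hδ, H⟩ := hT.exists_abs_iterate_sub_iterate_le hC hK he
  have h1 : ∀ᶠ i in l, |(k i : ℝ) * h i - k' i * h' i| < δ := by
    have := hkk.abs
    rw [abs_zero] at this
    exact this.eventually (gt_mem_nhds hδ)
  filter_upwards [hh.eventually (Ioo_mem_nhdsGT hδ), hh'.eventually (Ioo_mem_nhdsGT hδ), hk, hk',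
    h1] with i a b c d e
  exact H _ _ a.1 a.2 b.1 b.2 _ _ c d e

theorem tendsto_one_div_nat_nhdsGT : Tendsto (fun n : ℕ => 1 / (n : ℝ)) atTop (𝓝[>] 0) := by
  refine tendsto_nhdsWithin_iff.2 ⟨tendsto_one_div_atTop_nhds_zero_nat, ?_⟩
  filter_upwards [eventually_gt_atTop 0] with n hn
  exact one_div_pos.2 (show (0 : ℝ) < n from Nat.cast_pos.2 hn)

theorem tendsto_floor_mul_one_div {t : ℝ} (ht : 0 ≤ t) :
    Tendsto (fun n : ℕ => (⌊(n : ℝ) * t⌋₊ : ℝ) * (1 / (n : ℝ))) atTop (𝓝 t) := by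
  have := (tendsto_nat_floor_mul_div_atTop ht).comp tendsto_natCast_atTop_atTop
  refine this.congr fun n => ?_
  simp only [Function.comp, mul_one_div, mul_comm]

theorem floor_mul_one_div_le (n : ℕ) (t : unitInterval) :
    (⌊(n : ℝ) * t⌋₊ : ℝ) * (1 / (n : ℝ)) ≤ 1 := by
  rcases Nat.eq_zero_or_pos n with rfl | hn
  · simp
  have hn' : (0 : ℝ) < n := Nat.cast_pos.2 hn
  rw [mul_one_div, div_le_one hn']
  refine (Nat.floor_le (mul_nonneg hn'.le t.2.1)).trans ?_
  nlinarith [t.2.2]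

theorem floor_mul_mono (n : ℕ) {s t : unitInterval} (hst : s ≤ t) :
    ⌊(n : ℝ) * s⌋₊ ≤ ⌊(n : ℝ) * t⌋₊ :=
  Nat.floor_le_floor (mul_le_mul_of_nonneg_left hst (Nat.cast_nonneg n))

theorem floor_sub_floor_mul_le (n : ℕ) (s t : unitInterval) :
    ((⌊(n : ℝ) * t⌋₊ - ⌊(n : ℝ) * s⌋₊ : ℕ) : ℝ) * (1 / (n : ℝ)) ≤ 1 := by
  refine le_trans (mul_le_mul_of_nonneg_right ?_ (by positivity)) (floor_mul_one_div_le n t)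
  exact_mod_cast Nat.sub_le _ _

theorem tendsto_floor_sub_floor {s t : unitInterval} (hst : s ≤ t) :
    Tendsto (fun n : ℕ => ((⌊(n : ℝ) * t⌋₊ - ⌊(n : ℝ) * s⌋₊ : ℕ) : ℝ) * (1 / (n : ℝ))) atTop
      (𝓝 ((t : ℝ) - s)) := by
  refine ((tendsto_floor_mul_one_div t.2.1).sub (tendsto_floor_mul_one_div s.2.1)).congr fun n => ?_
  rw [Nat.cast_sub (floor_mul_mono n hst), sub_mul]

theorem isRandomVariable_canonical {d : ℕ} (t : unitInterval) :
    IsRandomVariable (cylinderLip d) (canonical d t) := fun φ hφ =>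
  mem_cylinderLip (ι := Fin 1) (fun _ => t) (φ := fun y => φ (y 0))
    (hφ.comp (LipschitzWith.eval 0))

theorem isRandomVariable_canonical_pair {d n : ℕ} (τ : Fin n → unitInterval) (s t : unitInterval) :
    IsRandomVariable (cylinderLip d) (fun w =>
      ((fun i : Fin n => canonical d (τ i) w), canonical d t w - canonical d s w)) := by
  intro φ hφ
  have hP : IsLinearMap ℝ (fun (y : Fin n ⊕ Bool → Euc d) =>
      ((fun i : Fin n => y (Sum.inl i)), y (Sum.inr true) - y (Sum.inr false))) := by
    refine ⟨fun p p' => Prod.ext rfl ?_, fun r p => Prod.ext rfl ?_⟩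
    · simp only [Pi.add_apply, Prod.snd_add]
      abel
    · simp only [Pi.smul_apply, Prod.smul_snd, smul_sub]
  obtain ⟨L, hL⟩ := exists_lipschitzWith_of_isLinearMap hP
  exact mem_cylinderLip (Sum.elim τ fun b => if b then t else s) (hφ.comp hL)

section

variable {Ω : Type*} {d : ℕ} {H : Set (Ω → ℝ)} {E : (Ω → ℝ) → ℝ} {Z : ℕ → Ω → Euc d} {α : ℝ}
  {G : (Euc d → ℝ) → Euc d → ℝ}

theorem IsIID.tendsto_iterate_increment (hE : IsSublinearExpectation H E) (hZ : IsIID H E Z)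
    {s t : unitInterval} (hst : s ≤ t) {φ : Euc d → ℝ} (hφ : BddLip φ) :
    Tendsto (fun n : ℕ => (stepOp E α (Z 0) (1 / (n : ℝ)))^[⌊(n : ℝ) * t⌋₊ - ⌊(n : ℝ) * s⌋₊] φ 0)
      (hyperfilter ℕ : Filter ℕ)
      (𝓝 (walkLimit E α Z fun w => φ (canonical d t w - canonical d s w))) := by
  have hmem : (fun w => φ (canonical d t w - canonical d s w)) ∈ cylinderLip d :=
    isRandomVariable_canonical_pair (n := 0) (fun i => i.elim0) s t _
      (hφ.comp (φ := Prod.snd) LipschitzWith.prod_snd)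
  refine (hZ.tendsto_walkLimit hE α hmem).congr fun n => ?_
  rw [← hZ.expect_sub_eq hE α (1 / (n : ℝ)) (floor_mul_mono n hst) hφ]
  simp only [smul_sub]
  rfl

theorem IsIID.tendsto_iterate (hE : IsSublinearExpectation H E) (hZ : IsIID H E Z)
    (t : unitInterval) {φ : Euc d → ℝ} (hφ : BddLip φ) :
    Tendsto (fun n : ℕ => (stepOp E α (Z 0) (1 / (n : ℝ)))^[⌊(n : ℝ) * t⌋₊] φ 0)
      (hyperfilter ℕ : Filter ℕ) (𝓝 (walkLimit E α Z fun w => φ (canonical d t w))) := by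
  have := hZ.tendsto_iterate_increment hE (α := α) (s := 0) (t := t) unitInterval.nonneg' hφ
  simpa [canonical_zero] using this

/-- The increment and the position at time `r` may use different numbers of steps for the same `n`,
but the total times have the same limit, so the Cauchy estimate identifies the two. -/
theorem IsIID.walkLimit_stationary (hE : IsSublinearExpectation H E) (hZ : IsIID H E Z)
    (hT : IsChernoffFamily α (stepOp E α (Z 0)) G) {s t r : unitInterval}
    (hr : (r : ℝ) = t - s) :
    IdentDist (walkLimit E α Z) (fun w => canonical d t w - canonical d s w) (walkLimit E α Z)
      (canonical d r) := by
  intro φ hφ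
  have hst : s ≤ t := by
    have := r.2.1
    change (s : ℝ) ≤ t
    linarith
  obtain ⟨C, K, hC, hK, hφL⟩ := hφ.exists_with
  have h1 := hZ.tendsto_iterate_increment hE (α := α) hst hφ
  have h2 := hZ.tendsto_iterate hE (α := α) r hφ
  refine sub_eq_zero.1 (tendsto_nhds_unique (h1.sub h2) ?_)
  rw [Metric.tendsto_nhds]
  intro e he
  have := hT.eventually_abs_iterate_sub_le hC hK (half_pos he) tendsto_one_div_nat_nhdsGT
    tendsto_one_div_nat_nhdsGT (Eventually.of_forall fun n => floor_sub_floor_mul_le n s t)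
    (Eventually.of_forall fun n => floor_mul_one_div_le n r)
    (by simpa [hr] using (tendsto_floor_sub_floor hst).sub (tendsto_floor_mul_one_div r.2.1))
  filter_upwards [this.filter_mono Nat.hyperfilter_le_atTop] with n hn
  rw [Real.dist_eq, sub_zero]
  exact (hn φ hφL 0).trans_lt (half_lt_self he)

theorem IsIID.walkLimit_indep (hE : IsSublinearExpectation H E) (hZ : IsIID H E Z)
    (hT : IsChernoffFamily α (stepOp E α (Z 0)) G) {m : ℕ} {τ : Fin m → unitInterval}
    {s t : unitInterval} (hτ : ∀ i, τ i ≤ s) (hst : s ≤ t) :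
    IndepFrom (cylinderLip d) (walkLimit E α Z) (fun w => canonical d t w - canonical d s w)
      (fun w i => canonical d (τ i) w) := by
  refine ⟨isRandomVariable_canonical_pair τ s t, fun φ hφ => ?_⟩
  obtain ⟨C, K, hC, hK, hφL⟩ := hφ.exists_with
  have hφx : ∀ x, BddLipWith C K (fun y => φ (x, y)) := fun x =>
    ⟨fun y => hφL.1 _, fun y y' => by simpa [Prod.dist_eq] using hφL.2 (x, y) (x, y')⟩
  set T := stepOp E α (Z 0)
  set k : ℕ → ℕ := fun n => ⌊(n : ℝ) * t⌋₊ - ⌊(n : ℝ) * s⌋₊ with hk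
  set ψ : (Fin m → Euc d) → ℝ := fun x =>
    walkLimit E α Z fun w => φ (x, canonical d t w - canonical d s w) with hψ
  have hψlim : ∀ x, Tendsto (fun n : ℕ => (T (1 / (n : ℝ)))^[k n] (fun y => φ (x, y)) 0)
      (hyperfilter ℕ : Filter ℕ) (𝓝 (ψ x)) := fun x =>
    hZ.tendsto_iterate_increment hE hst (hφx x).bddLip
  have hψL : BddLipWith C K ψ := by
    refine ⟨fun x => ?_, fun x x' => ?_⟩
    · exact le_of_tendsto (hψlim x).abs (Eventually.of_forall fun n =>
        (((hT.op _).iterate _).bddLipWith (hφx x)).1 0)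
    · refine le_of_tendsto ((hψlim x).sub (hψlim x')).abs (Eventually.of_forall fun n => ?_)
      exact ((hT.op _).iterate _).abs_sub_le (hφx x).bddLip (hφx x').bddLip
        (fun y => by simpa [Prod.dist_eq] using hφL.2 (x, y) (x', y)) 0
  -- Passing to the limit inside the outer expectation requires convergence uniform in the past `x`.
  -- It holds because all `φ(x, ·)` share the constants `C` and `K`: the Cauchy estimate is taken in
  -- two indices, and the second is sent to the limit.
  have hunif : ∀ e > 0, ∀ᶠ n : ℕ in (hyperfilter ℕ : Filter ℕ), ∀ x,
      |(T (1 / (n : ℝ)))^[k n] (fun y => φ (x, y)) 0 - ψ x| ≤ e := by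
    intro e he
    have hc := tendsto_floor_sub_floor hst
    have hdiff := (hc.comp (tendsto_fst (g := (atTop : Filter ℕ)))).sub
      (hc.comp (tendsto_snd (f := (atTop : Filter ℕ))))
    have h1 := hT.eventually_abs_iterate_sub_le (l := atTop ×ˢ atTop)
      (h := fun p : ℕ × ℕ => 1 / (p.1 : ℝ)) (h' := fun p : ℕ × ℕ => 1 / (p.2 : ℝ))
      (k := fun p => k p.1) (k' := fun p => k p.2) hC hK he
      (tendsto_one_div_nat_nhdsGT.comp tendsto_fst)
      (tendsto_one_div_nat_nhdsGT.comp tendsto_snd)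
      (Eventually.of_forall fun n => floor_sub_floor_mul_le n.1 s t)
      (Eventually.of_forall fun n => floor_sub_floor_mul_le n.2 s t)
      (by simpa using hdiff)
    refine (h1.curry.filter_mono Nat.hyperfilter_le_atTop).mono fun n hn x => ?_
    refine le_of_tendsto ((tendsto_const_nhds.sub (hψlim x)).abs) ?_
    filter_upwards [hn.filter_mono Nat.hyperfilter_le_atTop] with n' hn'
    exact hn' _ (hφx x) 0
  have hpair := hZ.tendsto_walkLimit hE α (isRandomVariable_canonical_pair τ s t φ hφ)
  have hψmem : (fun w => ψ fun i => canonical d (τ i) w) ∈ cylinderLip d :=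
    mem_cylinderLip τ hψL.bddLip
  have hψpast := hZ.tendsto_walkLimit hE α hψmem
  refine sub_eq_zero.1 (tendsto_nhds_unique (hpair.sub hψpast) ?_)
  rw [Metric.tendsto_nhds]
  intro e he
  filter_upwards [hunif (e / 2) (half_pos he)] with n hn
  rw [Real.dist_eq, sub_zero]
  refine lt_of_le_of_lt ?_ (half_lt_self he)
  have h1 := hZ.expect_pair_eq hE α (1 / (n : ℝ)) (fun i => ⌊(n : ℝ) * τ i⌋₊)
    (fun i => floor_mul_mono n (hτ i)) (floor_mul_mono n hst) hφ
  have h2 : (E fun ω => φ ((fun i => canonical d (τ i) (walkPath α Z n ω)),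
      canonical d t (walkPath α Z n ω) - canonical d s (walkPath α Z n ω)))
      = E fun ω => (T (1 / (n : ℝ)))^[k n] (fun y =>
        φ (fun i => canonical d (τ i) (walkPath α Z n ω), y)) 0 := by
    refine Eq.trans ?_ h1
    simp only [smul_sub]
    rfl
  rw [h2]
  refine hE.abs_sub_le ?_ (hZ.comp_walkPath_mem hE α hψmem n) fun ω => hn _
  have h3 : BddLipWith C K (fun x : Fin m → Euc d =>
      (T (1 / (n : ℝ)))^[k n] (fun y => φ (x, y)) 0) :=
    ⟨fun x => (((hT.op _).iterate _).bddLipWith (hφx x)).1 0, fun x x' =>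
      ((hT.op _).iterate _).abs_sub_le (hφx x).bddLip (hφx x').bddLip
        (fun y => by simpa [Prod.dist_eq] using hφL.2 (x, y) (x', y)) 0⟩
  exact hZ.comp_walkPath_mem hE α (mem_cylinderLip τ h3.bddLip) n

/-- The Cauchy estimate compares `n` steps of size `t / n` with `⌊n' t⌋` steps of size `1 / n'`.
Sending `n'` along the ultrafilter leaves convergence in `n` along the full sequence. At `t = 0` the
step size is not positive and both sides equal `φ 0`. -/
theorem IsIID.tendsto_walkLimit_canonical (hE : IsSublinearExpectation H E) (hZ : IsIID H E Z)
    (hT : IsChernoffFamily α (stepOp E α (Z 0)) G) (t : unitInterval) {φ : Euc d → ℝ}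
    (hφ : BddLip φ) :
    Tendsto (fun n : ℕ => E (fun ω => φ ((((t : ℝ) / (n : ℝ)) ^ (1 / α)) • partialSum Z n ω)))
      atTop (𝓝 (walkLimit E α Z (fun w => φ (canonical d t w)))) := by
  obtain ⟨C, K, hC, hK, hφL⟩ := hφ.exists_with
  have hlim := hZ.tendsto_iterate hE (α := α) t hφ
  simp only [hZ.expect_partialSum_eq hE α _ _ hφ]
  rcases t.2.1.eq_or_lt with ht | ht
  · have h0 : t = 0 := Subtype.ext ht.symm
    subst h0
    have hα := hT.pos.ne'
    have h1 : ∀ n : ℕ, (stepOp E α (Z 0) (((0 : unitInterval) : ℝ) / n))^[n] φ 0 = φ 0 := by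
      intro n
      rw [← hZ.expect_partialSum_eq hE α _ _ hφ]
      simp [hα, hE.const]
    have h2 : walkLimit E α Z (fun w => φ (canonical d 0 w)) = φ 0 := by
      simp only [canonical_zero]
      exact (hZ.isSublinearExpectation_walkLimit hE α).const _
    rw [h2]
    simp only [h1]
    exact tendsto_const_nhds
  · rw [Metric.tendsto_nhds]
    intro e he
    have hd : Tendsto (fun n : ℕ => (t : ℝ) / n) atTop (𝓝[>] 0) := by
      refine tendsto_nhdsWithin_iff.2 ⟨tendsto_const_div_atTop_nhds_zero_nat _, ?_⟩
      filter_upwards [eventually_gt_atTop 0] with n hn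
      exact div_pos ht (Nat.cast_pos.2 hn)
    have hdn : ∀ᶠ n : ℕ in atTop, (n : ℝ) * (t / n) = t := by
      filter_upwards [eventually_gt_atTop 0] with n hn
      have : (n : ℝ) ≠ 0 := Nat.cast_ne_zero.2 hn.ne'
      field_simp
    have hdt : Tendsto (fun n : ℕ => (n : ℝ) * (t / n)) atTop (𝓝 (t : ℝ)) :=
      tendsto_const_nhds.congr' (hdn.mono fun n hn => hn.symm)
    have hdiff := (hdt.comp (tendsto_fst (g := (atTop : Filter ℕ)))).sub
      ((tendsto_floor_mul_one_div t.2.1).comp (tendsto_snd (f := (atTop : Filter ℕ))))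
    have h1 := hT.eventually_abs_iterate_sub_le (l := atTop ×ˢ atTop)
      (h := fun p : ℕ × ℕ => (t : ℝ) / p.1) (h' := fun p : ℕ × ℕ => 1 / (p.2 : ℝ))
      (k := fun p => p.1) (k' := fun p => ⌊(p.2 : ℝ) * t⌋₊) hC hK (half_pos he)
      (hd.comp tendsto_fst) (tendsto_one_div_nat_nhdsGT.comp tendsto_snd)
      (tendsto_fst.eventually (hdn.mono fun n hn => hn.le.trans t.2.2))
      (Eventually.of_forall fun n => floor_mul_one_div_le n.2 t)
      (by simpa using hdiff)
    refine h1.curry.mono fun n hn => ?_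
    refine lt_of_le_of_lt ?_ (half_lt_self he)
    rw [Real.dist_eq]
    refine le_of_tendsto (tendsto_const_nhds.sub hlim).abs ?_
    filter_upwards [hn.filter_mono Nat.hyperfilter_le_atTop] with n' hn'
    exact hn' _ hφL 0

theorem IsIID.isLimitProcess_walkLimit (hE : IsSublinearExpectation H E) (hZ : IsIID H E Z)
    (hT : IsChernoffFamily α (stepOp E α (Z 0)) G) :
    IsLimitProcess E α Z (walkLimit E α Z) where
  sublinear := hZ.isSublinearExpectation_walkLimit hE α
  levy :=
    { randomVariable := isRandomVariable_canonical
      cadlag := fun w => w.2.2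
      zero := canonical_zero
      stationary := fun _ _ _ hr => hZ.walkLimit_stationary hE hT hr
      indep := fun _ _ _ _ _ hτ hst => hZ.walkLimit_indep hE hT hτ hst }
  limit := fun t _ hφ => hZ.tendsto_walkLimit_canonical hE hT t hφ

/-- The short time behaviour of every limiting process on `C_b^3` functions. -/
theorem IsLimitProcess.tendsto_div (hE : IsSublinearExpectation H E) (hZ : IsIID H E Z)
    (hT : IsChernoffFamily α (stepOp E α (Z 0)) G) {E' : (PathSpace d → ℝ) → ℝ}
    (hE' : IsLimitProcess E α Z E') {φ : Euc d → ℝ} (hφ : IsCb3 φ) (hφ0 : φ 0 = 0) :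
    Tendsto (fun s : unitInterval => E' (fun w => φ (canonical d s w)) / (s : ℝ)) (𝓝[>] 0)
      (𝓝 (G φ 0)) := by
  obtain ⟨C, K, hC, hK, hφL⟩ := hφ.bddLip.exists_with
  rw [Metric.tendsto_nhds]
  intro e he
  -- `τ` is fixed before `s` and `n`; with `k = n` and `h = s / n` the total time is exactly `s`, so
  -- for `s < τ` the expansion survives `n → ∞`. Only the one-time limits defining `E'` are used,
  -- which makes the result valid for every limiting expectation.
  obtain ⟨τ, hτ, hexp⟩ := hT.exists_time_abs_iterate_sub_sub_le
    (hT.uniformlyConsistent_singleton hφ) hC hK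
    (fun w hw => by rw [mem_singleton_iff.1 hw]; exact hφL) (half_pos he)
  have h1 : ∀ᶠ s : unitInterval in 𝓝 0, (s : ℝ) < τ :=
    continuous_subtype_val.continuousAt.eventually (gt_mem_nhds (by simpa using hτ))
  filter_upwards [mem_nhdsWithin_of_mem_nhds h1, self_mem_nhdsWithin] with s hs hs0
  have hs0 : (0 : ℝ) < s := hs0
  have hlim := hE'.limit s φ hφ.bddLip
  simp only [hZ.expect_partialSum_eq hE α _ _ hφ.bddLip] at hlim
  have hd : Tendsto (fun n : ℕ => (s : ℝ) / n) atTop (𝓝[>] 0) := by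
    refine tendsto_nhdsWithin_iff.2 ⟨tendsto_const_div_atTop_nhds_zero_nat _, ?_⟩
    filter_upwards [eventually_gt_atTop 0] with n hn
    exact div_pos hs0 (Nat.cast_pos.2 hn)
  have hbound : |E' (fun w => φ (canonical d s w)) - s * G φ 0| ≤ s * (e / 2) := by
    refine le_of_tendsto (hlim.sub tendsto_const_nhds).abs ?_
    filter_upwards [hd.eventually hexp, eventually_gt_atTop 0] with n hn hn0
    have hns : (n : ℝ) * (s / n) = s := by
      have : (n : ℝ) ≠ 0 := Nat.cast_ne_zero.2 hn0.ne'
      field_simp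
    have := hn n (by rw [hns]; exact hs.le) φ rfl 0
    rwa [hns, hφ0, sub_zero] at this
  rw [Real.dist_eq]
  have h2 : E' (fun w => φ (canonical d s w)) / (s : ℝ) - G φ 0
      = (s : ℝ)⁻¹ * (E' (fun w => φ (canonical d s w)) - s * G φ 0) := by
    field_simp
  rw [h2, abs_mul, abs_of_pos (inv_pos.2 hs0)]
  have h3 : (s : ℝ)⁻¹ * |E' (fun w => φ (canonical d s w)) - s * G φ 0| ≤ e / 2 := by
    rwa [inv_mul_le_iff₀ hs0]
  linarith

end

/-! ### Integrability with respect to stable Lévy measures -/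

/-- For `α < 1` the Lipschitz bound suffices and `β = 1`. For `α = 1` the compensated difference is
quadratic near the origin by Taylor's formula, giving `β = 2`. -/
theorem exists_abs_jumpDiff_le {d : ℕ} {α : ℝ} (hα : α ≤ 1) {φ : Euc d → ℝ} (hφ : IsCb3 φ) :
    ∃ (C : ℝ) (β : ℕ), 0 ≤ C ∧ α < β ∧ ∀ y, |jumpDiff α φ 0 y| ≤ C * min 1 (‖y‖ ^ β) := by
  obtain ⟨C, K, hC, hK, hφL⟩ := hφ.bddLip.exists_with
  have hbd : ∀ y, |φ y - φ 0| ≤ 2 * C := fun y =>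
    (abs_sub _ _).trans (by linarith [hφL.1 y, hφL.1 0])
  rcases hα.lt_or_eq with h1 | rfl
  · refine ⟨2 * C + K, 1, by positivity, by simpa using h1, fun y => ?_⟩
    have hy := hφL.2 y 0
    rw [dist_zero_right] at hy
    rw [jumpDiff, if_neg h1.ne, zero_add, pow_one]
    rcases le_total 1 ‖y‖ with h | h
    · rw [min_eq_left h]
      linarith [hbd y]
    · rw [min_eq_right h]
      nlinarith [norm_nonneg y]
  · obtain ⟨M, hM⟩ := hφ.2 2 (by norm_num)
    have hM0 : 0 ≤ M := (norm_nonneg _).trans (hM 0)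
    have hd1 : Differentiable ℝ φ := hφ.1.differentiable (by norm_num)
    have hd2 : Differentiable ℝ (fderiv ℝ φ) :=
      (hφ.1.fderiv_right (m := 1) (by norm_num)).differentiable (by norm_num)
    have hD : ∀ z, ‖fderiv ℝ φ z - fderiv ℝ φ 0‖ ≤ M * ‖z‖ := fun z => by
      have := convex_univ.norm_image_sub_le_of_norm_fderiv_le (𝕜 := ℝ) (f := fderiv ℝ φ) (C := M)
        (fun x _ => hd2 x) (fun x _ => by
          have := hM x
          rwa [← norm_iteratedFDeriv_fderiv, ← norm_iteratedFDeriv_fderiv,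
            norm_iteratedFDeriv_zero] at this) (mem_univ 0) (mem_univ z)
      simpa using this
    refine ⟨2 * C + M, 2, by positivity, by norm_num, fun y => ?_⟩
    rw [jumpDiff, if_pos rfl, zero_add]
    rcases le_or_gt ‖y‖ 1 with h | h
    · rw [if_pos h, min_eq_right (pow_le_one₀ (norm_nonneg y) h)]
      have := (convex_closedBall (0 : Euc d) ‖y‖).norm_image_sub_le_of_norm_fderiv_le' (𝕜 := ℝ)
        (f := φ) (φ := fderiv ℝ φ 0) (C := M * ‖y‖) (fun x _ => hd1 x)
        (fun x hx => (hD x).trans (mul_le_mul_of_nonneg_left (by simpa using hx) hM0))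
        (Metric.mem_closedBall_self (norm_nonneg y)) (y := y) (by simp)
      rw [sub_zero, Real.norm_eq_abs] at this
      nlinarith [sq_nonneg ‖y‖]
    · rw [if_neg (not_le.2 h), map_zero, sub_zero, min_eq_left (one_le_pow₀ h.le)]
      linarith [hbd y]

theorem measurable_jumpDiff {d : ℕ} (α : ℝ) {φ : Euc d → ℝ} (hφ : IsCb3 φ) (x : Euc d) :
    Measurable (jumpDiff α φ x) := by
  have h1 : Measurable fun y => φ (x + y) - φ x :=
    ((hφ.1.continuous.comp (continuous_const.add continuous_id)).sub continuous_const).measurable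
  unfold jumpDiff
  by_cases hα : α = 1
  · simp only [if_pos hα]
    refine h1.sub ((fderiv ℝ φ x).continuous.measurable.comp ?_)
    exact Measurable.ite (measurableSet_le measurable_norm measurable_const) measurable_id
      measurable_const
  · simp only [if_neg hα]
    exact h1

/-- `α < β` gives integrability at zero, and `0 < α` gives it at infinity. -/
theorem integrableOn_rpow_mul_min {α : ℝ} (hα : 0 < α) {β : ℕ} (hβ : α < β) (C : ℝ) :
    IntegrableOn (fun r : ℝ => r ^ (-(1 + α)) * (C * min 1 (|r| ^ β))) (Ioi 0) := by
  rw [← Ioc_union_Ioi_eq_Ioi zero_le_one]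
  refine IntegrableOn.union ?_ ?_
  · have h1 : IntegrableOn (fun r : ℝ => C * r ^ ((β : ℝ) - (1 + α))) (Ioc 0 1) := by
      have := (intervalIntegral.intervalIntegrable_rpow' (a := 0) (b := 1)
        (r := (β : ℝ) - (1 + α)) (by linarith)).const_mul C
      rwa [intervalIntegrable_iff_integrableOn_Ioc_of_le zero_le_one] at this
    refine h1.congr_fun (fun r hr => ?_) measurableSet_Ioc
    simp only
    rw [abs_of_pos hr.1, min_eq_right (pow_le_one₀ hr.1.le hr.2), ← Real.rpow_natCast,
      sub_eq_add_neg, Real.rpow_add hr.1]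
    ring
  · have h1 : IntegrableOn (fun r : ℝ => C * r ^ (-(1 + α))) (Ioi 1) :=
      (integrableOn_Ioi_rpow_of_lt (by linarith) one_pos).const_mul C
    refine h1.congr_fun (fun r hr => ?_) measurableSet_Ioi
    have hr : 1 < r := hr
    simp only
    rw [abs_of_pos (one_pos.trans hr), min_eq_left (one_le_pow₀ hr.le)]
    ring

theorem lintegral_stableMeasure_le {d : ℕ} {α C : ℝ} {β : ℕ} {f : Euc d → ℝ}
    (hf : Measurable f) (hfle : ∀ y, |f y| ≤ C * min 1 (‖y‖ ^ β)) (μ : Measure (Sph d))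
    [IsFiniteMeasure μ] :
    ∫⁻ y, ‖f y‖ₑ ∂(stableMeasure α μ) ≤ μ univ *
      ∫⁻ r in Ioi (0 : ℝ), ENNReal.ofReal (r ^ (-(1 + α)) * (C * min 1 (|r| ^ β))) := by
  have hmeas : Measurable (fun p : Sph d × ℝ => p.2 • (p.1 : Euc d)) := by fun_prop
  have hg : Measurable fun r : ℝ => ENNReal.ofReal (C * min 1 (|r| ^ β)) := by fun_prop
  have hw : Measurable fun r : ℝ => ENNReal.ofReal (r ^ (-(1 + α))) := by fun_prop
  rw [stableMeasure, lintegral_map hf.enorm hmeas]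
  have h1 : ∀ p : Sph d × ℝ, ‖f (p.2 • (p.1 : Euc d))‖ₑ
      ≤ ENNReal.ofReal (C * min 1 (|p.2| ^ β)) := fun p => by
    rw [← ofReal_norm]
    refine ENNReal.ofReal_le_ofReal ((hfle _).trans (le_of_eq ?_))
    rw [norm_smul, Real.norm_eq_abs, norm_eq_of_mem_sphere, mul_one]
  refine (lintegral_mono h1).trans (le_of_eq ?_)
  refine (lintegral_prod _ (hg.comp measurable_snd).aemeasurable).trans ?_
  simp only [Function.comp_apply, lintegral_const]
  rw [mul_comm, lintegral_withDensity_eq_lintegral_mul _ hw hg]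
  congr 1
  refine setLIntegral_congr_fun measurableSet_Ioi fun r hr => ?_
  rw [Pi.mul_apply, ENNReal.ofReal_mul (Real.rpow_nonneg (le_of_lt hr) _)]

/-- In polar form the integral of `|δφ|` is at most the mass of `μ` times one radial integral, and
the mass is below `Λhi`. This guards against default values: it makes the integrals and the real
supremum in `supGenerator` at `0` genuine. -/
theorem integrable_and_bddAbove_jumpDiff {d : ℕ} {α : ℝ} (hα : α ∈ Ioc (0 : ℝ) 1) (Λlo Λhi : ℝ)
    {φ : Euc d → ℝ} (hφ : IsCb3 φ) :
    (∀ F ∈ jumpSet d α Λlo Λhi, Integrable (jumpDiff α φ 0) F) ∧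
      BddAbove (range fun F : jumpSet d α Λlo Λhi =>
        ∫ y, jumpDiff α φ 0 y ∂(F : Measure (Euc d))) := by
  obtain ⟨C, β, hC, hβ, hle⟩ := exists_abs_jumpDiff_le hα.2 hφ
  have hm := measurable_jumpDiff α hφ 0
  set J : ℝ≥0∞ := ∫⁻ r in Ioi (0 : ℝ), ENNReal.ofReal (r ^ (-(1 + α)) * (C * min 1 (|r| ^ β)))
  have hJ : J < ⊤ := (integrableOn_rpow_mul_min hα.1 hβ C).lintegral_lt_top
  have hB : ENNReal.ofReal Λhi * J < ⊤ := ENNReal.mul_lt_top ENNReal.ofReal_lt_top hJ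
  have key : ∀ F ∈ jumpSet d α Λlo Λhi, ∫⁻ y, ‖jumpDiff α φ 0 y‖ₑ ∂F ≤ ENNReal.ofReal Λhi * J := by
    rintro _ ⟨μ, hμ, -, hμΛ, rfl⟩
    exact (lintegral_stableMeasure_le hm hle μ).trans (mul_le_mul_left hμΛ.2.le _)
  refine ⟨fun F hF => ⟨hm.aestronglyMeasurable, (key F hF).trans_lt hB⟩,
    (ENNReal.ofReal Λhi * J).toReal, ?_⟩
  rintro _ ⟨F, rfl⟩
  refine (le_abs_self _).trans ?_
  rw [← Real.norm_eq_abs]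
  refine (norm_integral_le_lintegral_norm _).trans (ENNReal.toReal_mono hB.ne ?_)
  simpa only [ofReal_norm] using key F F.2

end NonlinearLevy

/-! ### The main theorem -/

theorem theorem4p5 {Ω : Type*} {d : ℕ} (H : Set (Ω → ℝ)) (E : (Ω → ℝ) → ℝ)
    (hE : IsSublinearExpectation H E)
    (α : ℝ) (hα : α ∈ Ioc (0 : ℝ) 1) (Λlo Λhi : ℝ) (hΛlo : 0 < Λlo) (hΛ : Λlo < Λhi)
    (Z : ℕ → Ω → Euc d) (hZ : IsIID H E Z)
    (hnonint : ∀ i, extExp H E (fun ω => ‖Z i ω‖) = ⊤)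
    (hA1 : MomentCondition H E α Z)
    (hA2 : ConsistencyCondition E α Λlo Λhi (Z 0)) :
    (∃ E' : (PathSpace d → ℝ) → ℝ, IsLimitProcess E α Z E') ∧
    ∀ φ : Euc d → ℝ, IsCb3 φ → φ 0 = 0 →
      (∀ F ∈ jumpSet d α Λlo Λhi, Integrable (jumpDiff α φ 0) F) ∧
      BddAbove (range fun F : jumpSet d α Λlo Λhi =>
        ∫ y, jumpDiff α φ 0 y ∂(F : Measure (Euc d))) ∧
      ∀ E' : (PathSpace d → ℝ) → ℝ, IsLimitProcess E α Z E' →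
        Tendsto (fun s : unitInterval => E' (fun w => φ (canonical d s w)) / (s : ℝ))
          (𝓝[>] 0) (𝓝 (supGenerator α Λlo Λhi φ 0)) := by
  have hT := isChernoffFamily_stepOp hE hα.1 (hZ.randomVariable 0) hA2
  refine ⟨⟨_, hZ.isLimitProcess_walkLimit hE hT⟩, fun φ hφ hφ0 => ?_⟩
  obtain ⟨h1, h2⟩ := integrable_and_bddAbove_jumpDiff hα Λlo Λhi hφ
  exact ⟨h1, h2, fun E' hE' => hE'.tendsto_div hE hZ hT hφ hφ0⟩
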